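/- Let $D>0$ and $m>0$ be real numbers, put $d=D+m$ and $\epsilon=D-2+\tfrac12 m$, and assume $0<\epsilon<2$. For $p,q>0$ let $$I_{D,m}(p,q)=\int\frac{d^mq'}{(2\pi)^m}\int\frac{d^Dp'}{(2\pi)^D}\,\frac{1}{p'^2+q'^4}\,\frac{1}{|\boldsymbol p'+\boldsymbol p|^2+|\boldsymbol q'+\boldsymbol q|^4},\qquad |\boldsymbol p|=p,\ |\boldsymbol q|=q.$$ For integers $D,m\ge1$ this is the (convergent) Lebesgue integral over $\mathbb R^m\times\mathbb R^D$. For real $D,m$ it is the standard integral in continuous dimension: a function of $k$ that depends only on the component $x$ of $k$ along the external vector and on the squared length $u$ of its transverse part has the integral $\int d^Dk\,f(x,u)=\int_{-\infty}^{\infty}L_{D-1}[f(x,\cdot)]\,dx$, where $$L_\nu[g]=\frac{2\pi^{\nu/2}}{\Gamma(\nu/2)}\int_0^\infty r^{\nu-1}g(r^2)\,dr\ (\nu>0),\qquad L_0[g]=g(0),\qquad L_\nu[g]=\frac{2\pi^{\nu/2}}{\Gamma(\nu/2)}\int_0^\infty r^{\nu-1}\bigl(g(r^2)-g(0)\bigr)\,dr\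 (-1<\nu<0),$$ and for integer $D,m\ge1$ it agrees with the Lebesgue integral. Put $$a=4-D-\tfrac12m=2-\epsilon,\quad b=\frac{3-D}{2},\quad A_{D,m}=\frac{8}{(16\pi)^{(d-1)/2}}\,\frac{\Gamma(2-\epsilon)}{\Gamma\left(\frac{5-D}{2}\right)},\quad X=\frac{4p^2}{q^4},\quad \zeta=\frac{X}{1+X},$$ and, with the Pochhammer symbol $(x)_n=x(x+1)\cdots(x+n-1)$, $$B_n=\frac{(\frac12)_n\,(a)_n\,(b)_n}{(\frac32)_n\,(b+1)_n\,n!},\qquad F_{nk}={}_3F_2\left(\begin{matrix}-k,\ \tfrac12(a+n),\ \tfrac12(a+n+1)\\ \tfrac32+n,\ b+1+n\end{matrix};1\right)\qquad(n,k\ge0).$$ Then, for all $p,q>0$ (that is, for all values $X>0$), the following double series converges absolutely and $$I_{D,m}(p,q)=\frac{A_{D,m}\,q^{-4+2\epsilon}}{1+X}\sum_{n,k\ge0}B_n\,F_{nk}\,\zeta^k .$$ -/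

import Mathlib

open MeasureTheory Set

noncomputable section

namespace Lifshitz

/-- The integral `∫ d^ν k g(|k|²)` of a rotationally symmetric function over a space of real
dimension `ν > -2`: polar coordinates for `ν > 0`, evaluation at the origin for `ν = 0`, and for
`-2 < ν < 0` the usual continuation in the dimension, obtained by subtracting the value at the
origin from the integrand. -/
def radialIntegral (ν : ℝ) (g : ℝ → ℝ) : ℝ :=
  if 0 < ν then
    2 * Real.pi ^ (ν / 2) / Real.Gamma (ν / 2) * ∫ r in Ioi (0 : ℝ), r ^ (ν - 1) * g (r ^ 2)
  else if ν = 0 then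
    g 0
  else
    2 * Real.pi ^ (ν / 2) / Real.Gamma (ν / 2) *
      ∫ r in Ioi (0 : ℝ), r ^ (ν - 1) * (g (r ^ 2) - g 0)

/-- The integral `∫ d^D k f(x, u)` over a space of real dimension `D > 0`, where `x` is the
component of the vector `k` along a fixed direction and `u` is the square of the length of its
transverse part, which ranges over a space of dimension `D - 1`. -/
def dimIntegral (D : ℝ) (f : ℝ → ℝ → ℝ) : ℝ :=
  ∫ x : ℝ, radialIntegral (D - 1) (fun u => f x u)

/-- The integral `I_{D,m}(p,q)` for real dimensions `D` and `m`, as a function of the lengths `p`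
and `q` of the external vectors. The integration variables `p'` and `q'` are decomposed along the
external vectors: `p'` has component `x` and squared transverse length `u`, and `q'` has component
`y` and squared transverse length `w`. -/
def feynmanI (D m p q : ℝ) : ℝ :=
  ((2 * Real.pi) ^ m)⁻¹ * dimIntegral m (fun y w =>
    ((2 * Real.pi) ^ D)⁻¹ * dimIntegral D (fun x u =>
      1 / (x ^ 2 + u + (y ^ 2 + w) ^ 2) * (1 / ((x + p) ^ 2 + u + ((y + q) ^ 2 + w) ^ 2))))

/-- The integrand of `I_{D,m}(p,q)` for integer dimensions `D` and `m`. -/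
def integrand {D m : ℕ} (p : EuclideanSpace ℝ (Fin D)) (q : EuclideanSpace ℝ (Fin m))
    (q' : EuclideanSpace ℝ (Fin m)) (p' : EuclideanSpace ℝ (Fin D)) : ℝ :=
  1 / (‖p'‖ ^ 2 + ‖q'‖ ^ 4) * (1 / (‖p' + p‖ ^ 2 + ‖q' + q‖ ^ 4))

/-- The Pochhammer symbol `(x)_n = x (x + 1) ⋯ (x + n - 1)`. -/
def poch (x : ℝ) (n : ℕ) : ℝ := (ascPochhammer ℝ n).eval x

/-- The hypergeometric series `₃F₂(α, β, γ; δ, η; z)`. -/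
def hyp3F2 (α β γ δ η z : ℝ) : ℝ :=
  ∑' j : ℕ, poch α j * poch β j * poch γ j / (poch δ j * poch η j) * z ^ j / (j.factorial : ℝ)

/-- `ε = D - 2 + m / 2`. -/
def eps (D m : ℝ) : ℝ := D - 2 + m / 2

/-- `a = 4 - D - m / 2 = 2 - ε`. -/
def parA (D m : ℝ) : ℝ := 4 - D - m / 2

/-- `b = (3 - D) / 2`. -/
def parB (D : ℝ) : ℝ := (3 - D) / 2

/-- The prefactor `A_{D,m}`, with total dimension `d = D + m`. -/
def coeffA (D m : ℝ) : ℝ :=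
  8 / (16 * Real.pi) ^ ((D + m - 1) / 2) * (Real.Gamma (2 - eps D m) / Real.Gamma ((5 - D) / 2))

/-- The coefficient `B_n`. -/
def coeffB (D m : ℝ) (n : ℕ) : ℝ :=
  poch (1 / 2) n * poch (parA D m) n * poch (parB D) n /
    (poch (3 / 2) n * poch (parB D + 1) n * (n.factorial : ℝ))

/-- The coefficient `F_{nk}`, a terminating hypergeometric series of unit argument. -/
def coeffF (D m : ℝ) (n k : ℕ) : ℝ :=
  hyp3F2 (-(k : ℝ)) ((parA D m + n) / 2) ((parA D m + n + 1) / 2)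
    (3 / 2 + n) (parB D + 1 + n) 1

/-- The variable `X = 4 p² / q⁴`. -/
def varX (p q : ℝ) : ℝ := 4 * p ^ 2 / q ^ 4

/-- The variable `ζ = X / (1 + X)`. -/
def varZeta (p q : ℝ) : ℝ := varX p q / (1 + varX p q)

end Lifshitz

end

open MeasureTheory Set
noncomputable section
namespace Lifshitz

/-! For fixed `q'` the integral over `p'` is a one-loop integral with masses `m₁ = |q'|²` and `m₂ =
|q' + q|²`. With `σ = m₁ + m₂`, `δ = m₂ - m₁` and `R(v) = √(σ² + (1 - v²)p²)`, a change of the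
Feynman parameter makes its quadratic form the perfect square `((R + vδ)/2)²`
(`integral_feynmanMass_rpow`), so the integral becomes a constant times `∫ ((R + vδ)/2)^(D-3) / R
dv` over `[-1, 1]`. The binomial series in `vδ/R`, of which only even powers survive the symmetry `v
↦ -v`, gives the sum over `n` (`hasSum_one_loop`).

Centring at `-q/2` separates the variables: if `x` is the component of `q' + q/2` along `q` and `K =
|q' + q/2|²`, then `δ = 2qx` and `σ = 2K + q²/2`. Each term is `x^(2n)` times a decreasing function
of `K`, and its `m`-dimensional integral reduces to one over `K` (`IsProfile.lintegral_dimDiff`).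
Putting `K = (q²/4)(1 - t)/t` leaves beta averages of `(1 + t²(1 - v²)X)^(-c)` with `c = b + 1/2 +
n`. Multiplied by `1 + X = (1 - ζ)⁻¹`, this function is a power series in `ζ` with coefficients
`₂F₁(-k, c; 1; t²(1 - v²))`, for every `X > 0` (`hasSum_jacobiPoly`); the moments of `t` and `v`
turn these into `F_{nk}` (`hasSum_betaAverage`).

Convergence rests on `0 ≤ F_{nk} ≤ 1`, because `F_{nk}` is a `k`-th difference of a completely
monotone sequence (`coeffF_mem_Icc`), and on `∑ |B_n| < ∞`, which uses `a < 2`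
(`summable_abs_coeffB`). The condition `a > 0` makes the integral over `K` converge already for `n =
0`.

In a transverse dimension `ν < 0` the factor `Γ(ν/2)` is negative and the subtracted integrand of a
decreasing function is nonpositive. Moving the sign across makes every integral one of a nonnegative
function against a positive measure, so Tonelli applies uniformly in the dimension. Hence also the
integrals of the norms of the terms are the absolute values of their integrals, and absolute
convergence of the double series itself justifies summing under the integral. -/

theorem hasSum_of_forall_eq {f g : ℕ → ℝ} {a : ℝ} (hf : HasSum f a) (h : ∀ n, g n = f n) :
    HasSum g a := by
  rwa [show g = f from funext h]

/-! ### Pochhammer symbols and binomial series -/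

@[simp] theorem poch_zero (x : ℝ) : poch x 0 = 1 := by simp [poch]

theorem poch_succ (x : ℝ) (n : ℕ) : poch x (n + 1) = poch x n * (x + n) := by
  simp [poch, ascPochhammer_succ_eval]

theorem poch_succ_left (x : ℝ) (n : ℕ) : poch x (n + 1) = x * poch (x + 1) n := by
  simp [poch, ascPochhammer_succ_left]

theorem poch_pos {x : ℝ} (hx : 0 < x) (n : ℕ) : 0 < poch x n := ascPochhammer_pos n x hx

theorem poch_add (x : ℝ) (n k : ℕ) : poch x (n + k) = poch x n * poch (x + n) k := by
  induction k with
  | zero => simp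
  | succ k ih => rw [← add_assoc, poch_succ, ih, poch_succ]; push_cast; ring

theorem Gamma_add_nat {x : ℝ} (hx : 0 < x) (n : ℕ) :
    Real.Gamma (x + n) = poch x n * Real.Gamma x := by
  induction n with
  | zero => simp
  | succ n ih =>
    rw [poch_succ, Nat.cast_succ, ← add_assoc, Real.Gamma_add_one (by positivity), ih]; ring

theorem poch_two_mul (x : ℝ) (n : ℕ) :
    poch x (2 * n) = 4 ^ n * poch (x / 2) n * poch ((x + 1) / 2) n := by
  induction n with
  | zero => simp
  | succ n ih =>
    rw [show 2 * (n + 1) = 2 * n + 1 + 1 by ring, poch_succ, poch_succ, ih, poch_succ, poch_succ]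
    push_cast; ring

theorem poch_one (n : ℕ) : poch 1 n = (n.factorial : ℝ) := by
  simp [poch, ascPochhammer_eval_one]

/-- The coefficient `(x)_n / n!` of the binomial series of `(1 - z) ^ (-x)`. -/
def bincoef (x : ℝ) (n : ℕ) : ℝ := poch x n / (n.factorial : ℝ)

theorem bincoef_eq_multichoose (x : ℝ) (n : ℕ) : bincoef x n = Ring.multichoose x n := by
  have h := Ring.factorial_nsmul_multichoose_eq_ascPochhammer x n
  rw [Polynomial.ascPochhammer_smeval_eq_eval, nsmul_eq_mul] at h
  rw [bincoef, poch, ← h]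
  field_simp

theorem bincoef_nonneg {x : ℝ} (hx : 0 < x) (n : ℕ) : 0 ≤ bincoef x n :=
  div_nonneg (poch_pos hx n).le (by positivity)

theorem bincoef_eq_choose (x : ℝ) (n : ℕ) : bincoef x n = (-1) ^ n * Ring.choose (-x) n := by
  rw [bincoef_eq_multichoose, Ring.choose_neg', Units.smul_def, zsmul_eq_mul, ← mul_assoc]
  simp [← mul_pow]

/-- Vandermonde's identity: the coefficients of `(1 - z)^(-x) (1 - z)^(-y)`. -/
theorem bincoef_add (x y : ℝ) (n : ℕ) :
    bincoef (x + y) n = ∑ ij ∈ Finset.HasAntidiagonal.antidiagonal n, bincoef x ij.1 * bincoef y ij.2 := by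
  rw [bincoef_eq_choose, neg_add, Ring.add_choose_eq n (Commute.all _ _), Finset.mul_sum]
  refine Finset.sum_congr rfl fun ij hij => ?_
  rw [bincoef_eq_choose, bincoef_eq_choose, ← Finset.HasAntidiagonal.mem_antidiagonal.1 hij, pow_add]; ring

theorem hasSum_bincoef (x : ℝ) {z : ℝ} (hz : |z| < 1) :
    HasSum (fun n => bincoef x n * z ^ n) ((1 - z) ^ (-x)) := by
  have h := (Real.one_add_rpow_hasFPowerSeriesOnBall_zero (a := -x)).hasSum (y := -z)
    (by simpa [enorm_eq_nnnorm, ← NNReal.coe_lt_coe] using hz)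
  simp only [binomialSeries_apply, List.ofFn_const, List.prod_replicate, smul_eq_mul, 
    ← sub_eq_add_neg, zero_sub] at h
  refine hasSum_of_forall_eq h fun n => ?_
  rw [bincoef_eq_choose, neg_pow z]; ring

theorem summable_abs_bincoef (x : ℝ) {z : ℝ} (hz : |z| < 1) :
    Summable (fun n => |bincoef x n * z ^ n|) := by
  have h := (hasSum_bincoef x hz).summable
  exact h.abs

theorem hasSum_even_bincoef (x : ℝ) {w : ℝ} (hw : |w| < 1) :
    HasSum (fun n => bincoef x (2 * n) * w ^ (2 * n)) (((1 + w) ^ (-x) + (1 - w) ^ (-x)) / 2) := by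
  have h1 := hasSum_bincoef x hw
  have h2 := hasSum_bincoef x (z := -w) (by simpa using hw)
  have h := (h2.add h1).div_const 2
  rw [sub_neg_eq_add] at h
  have h0 : ∀ n ∉ Set.range (fun n : ℕ => 2 * n),
      (bincoef x n * (-w) ^ n + bincoef x n * w ^ n) / 2 = 0 := by
    intro n hn
    have : Odd n := by
      rw [← Nat.not_even_iff_odd]; rintro ⟨k, hk⟩; exact hn ⟨k, by simp; omega⟩
    rw [this.neg_pow]; ring
  have hinj : Function.Injective (fun n : ℕ => 2 * n) := fun a b hab => by simpa using hab
  rw [← hinj.hasSum_iff h0] at h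
  convert h using 2 with n
  simp only [Function.comp]
  rw [Even.neg_pow ⟨n, by ring⟩]; ring

/-- The duplication formula is applied to the numerator and also to `(2n)! = (1)_{2n}`; the powers
of 4 cancel. -/
theorem bincoef_two_mul (b : ℝ) (n : ℕ) :
    bincoef (2 * b) (2 * n) = poch b n * poch (b + 1 / 2) n / (poch (1 / 2) n * n.factorial) := by
  have h1 := poch_two_mul (2 * b) n
  have h2 := poch_two_mul 1 n
  rw [poch_one, show ((1 : ℝ) + 1) / 2 = 1 by norm_num, poch_one] at h2
  rw [bincoef, h1, h2, show 2 * b / 2 = b by ring, show (2 * b + 1) / 2 = b + 1 / 2 by ring]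
  have := (poch_pos (x := 1 / 2) (by norm_num) n).ne'
  field_simp

/-- The polynomials `₂F₁(-k, c; 1; τ)`. -/
def jacobiPoly (c : ℝ) (k : ℕ) (τ : ℝ) : ℝ :=
  ∑ j ∈ Finset.range (k + 1), (k.choose j : ℝ) * bincoef c j * (-τ) ^ j

theorem bincoef_succ_nat (j n : ℕ) : bincoef (j + 1) n = ((n + j).choose j : ℝ) := by
  rw [bincoef, div_eq_iff (by positivity)]
  have h := poch_add 1 j n
  rw [poch_one, poch_one, add_comm (1 : ℝ)] at h
  have h3 : (j.factorial : ℝ) ≠ 0 := by positivity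
  apply mul_left_cancel₀ h3
  rw [← h]
  have := Nat.add_choose_mul_factorial_mul_factorial n j
  rw [← Nat.choose_symm_add, add_comm n j] at *
  rw [← this]; push_cast; ring

theorem bincoef_mul_choose (c : ℝ) (j l : ℕ) :
    bincoef c (l + j) * ((l + j).choose j : ℝ) = bincoef c j * bincoef (c + j) l := by
  have := Nat.add_choose_mul_factorial_mul_factorial l j
  have h1 : (((l + j).choose j : ℕ) : ℝ) * l.factorial * j.factorial = (l + j).factorial := by
    rw [← Nat.choose_symm_add] at *
    exact_mod_cast this
  rw [bincoef, bincoef, bincoef, add_comm l j, poch_add, add_comm j l, ← h1]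
  have : ((l + j).choose j : ℝ) ≠ 0 := by
    exact_mod_cast (Nat.choose_pos (Nat.le_add_left j l)).ne'
  field_simp

/-- Re-expansion about `τ = 1`, which exhibits the polynomial as a Cauchy product coefficient of `(1
- z(1 - τ))^(-c)` and `(1 - z)^(-(1 - c))`. Both the generating function and the majorant on `[0,
1]` are read off from this form. -/
theorem jacobiPoly_eq_sum_antidiagonal (c τ : ℝ) (k : ℕ) :
    jacobiPoly c k τ =
      ∑ l ∈ Finset.range (k + 1), bincoef (1 - c) (k - l) * (bincoef c l * (1 - τ) ^ l) := by
  have h1 : ∀ l : ℕ, (1 - τ) ^ l = ∑ j ∈ Finset.range (l + 1), (-τ) ^ j * (l.choose j : ℝ) := by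
    intro l
    rw [sub_eq_add_neg, add_comm, add_pow]; simp
  simp_rw [h1, Finset.mul_sum]
  rw [Finset.sum_comm' (t' := Finset.range (k + 1)) (s' := fun j => Finset.Ico j (k + 1))
    (by intro x y; simp; omega)]
  refine Finset.sum_congr rfl fun j hj => ?_
  have hj' : j ≤ k := by simpa [Nat.lt_succ_iff] using hj
  rw [Finset.sum_Ico_eq_sum_range]
  have h2 := bincoef_add (c + j) (1 - c) (k - j)
  -- The parameters `c + j` and `1 - c` add up to the integer `j + 1`, so Vandermonde's sum
  -- collapses to an ordinary binomial coefficient.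
  rw [show c + j + (1 - c) = (j : ℝ) + 1 by ring, bincoef_succ_nat, Nat.sub_add_cancel hj',
    Finset.Nat.sum_antidiagonal_eq_sum_range_succ_mk] at h2
  rw [h2, Finset.sum_mul, Finset.sum_mul, show k + 1 - j = (k - j).succ by omega]
  refine Finset.sum_congr rfl fun l hl => ?_
  have h3 := bincoef_mul_choose c j l
  rw [add_comm j l, show k - (l + j) = k - j - l by omega]
  linear_combination (-(τ) ) ^ j * bincoef (1 - c) (k - j - l) * (-h3)

/-- A summable majorant of the polynomials `jacobiPoly c k` on the unit interval. -/
def jacobiBound (c : ℝ) (k : ℕ) : ℝ :=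
  ∑ l ∈ Finset.range (k + 1), |bincoef (1 - c) (k - l)| * |bincoef c l|

theorem abs_jacobiPoly_le (c : ℝ) (k : ℕ) {τ : ℝ} (h0 : 0 ≤ τ) (h1 : τ ≤ 1) :
    |jacobiPoly c k τ| ≤ jacobiBound c k := by
  rw [jacobiPoly_eq_sum_antidiagonal]
  refine (Finset.abs_sum_le_sum_abs _ _).trans (Finset.sum_le_sum fun l _ => ?_)
  rw [abs_mul, abs_mul, abs_pow]
  have : |1 - τ| ^ l ≤ 1 := pow_le_one₀ (abs_nonneg _) (by rw [abs_le]; constructor <;> linarith)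
  have h2 := mul_le_mul_of_nonneg_left this (abs_nonneg (bincoef c l))
  rw [mul_one] at h2
  exact mul_le_mul_of_nonneg_left h2 (abs_nonneg _)

theorem summable_jacobiBound (c : ℝ) {z : ℝ} (h0 : 0 ≤ z) (h1 : z < 1) :
    Summable (fun k => jacobiBound c k * z ^ k) := by
  have hz : |z| < 1 := by rwa [abs_of_nonneg h0]
  have h := summable_norm_sum_mul_antidiagonal_of_summable_norm
    (f := fun n => |bincoef c n * z ^ n|) (g := fun n => |bincoef (1 - c) n * z ^ n|)
    (by simpa using summable_abs_bincoef c hz) (by simpa using summable_abs_bincoef (1 - c) hz)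
  refine h.of_norm_bounded fun k => ?_
  rw [Finset.Nat.sum_antidiagonal_eq_sum_range_succ_mk, jacobiBound, Finset.sum_mul]
  refine le_of_eq (congrArg _ (Finset.sum_congr rfl fun l hl => ?_))
  have hl' : l ≤ k := by simpa [Nat.lt_succ_iff] using hl
  simp only [abs_mul, abs_pow, abs_of_nonneg h0]
  rw [← Nat.sub_add_cancel hl', pow_add, Nat.add_sub_cancel]; ring

/-- Since `1 - z(1 - τ) = (1 - z)(1 + z/(1 - z) τ)`, a function of `X = z/(1 - z)` is expanded in
`z` with convergence on all of `[0, 1)`, hence for every `X ≥ 0`; a series in `X` itself would not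
do this. -/
theorem hasSum_jacobiPoly (c : ℝ) {z τ : ℝ} (h0 : 0 ≤ z) (h1 : z < 1) (t0 : 0 ≤ τ) (t1 : τ ≤ 1) :
    HasSum (fun k => jacobiPoly c k τ * z ^ k)
      ((1 - z)⁻¹ * (1 + z / (1 - z) * τ) ^ (-c)) := by
  have hz : |z| < 1 := by rwa [abs_of_nonneg h0]
  have hzt0 : 0 ≤ z * (1 - τ) := mul_nonneg h0 (by linarith)
  have hzt1 : z * (1 - τ) < 1 := by nlinarith
  have hzt : |z * (1 - τ)| < 1 := by rwa [abs_of_nonneg hzt0]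
  have h := hasSum_sum_range_mul_of_summable_norm
    (f := fun n => bincoef c n * (z * (1 - τ)) ^ n) (g := fun n => bincoef (1 - c) n * z ^ n)
    (by simpa using summable_abs_bincoef c hzt) (by simpa using summable_abs_bincoef (1 - c) hz)
  rw [(hasSum_bincoef c hzt).tsum_eq, (hasSum_bincoef (1 - c) hz).tsum_eq] at h
  have hval : (1 - z * (1 - τ)) ^ (-c) * (1 - z) ^ (-(1 - c)) =
      (1 - z)⁻¹ * (1 + z / (1 - z) * τ) ^ (-c) := by
    have hp : 0 < 1 - z := by linarith
    have : 1 - z * (1 - τ) = (1 - z) * (1 + z / (1 - z) * τ) := by field_simp; ring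
    rw [this, Real.mul_rpow hp.le (by positivity), mul_right_comm, ← Real.rpow_add hp,
      show -c + -(1 - c) = (-1 : ℝ) by ring, Real.rpow_neg_one]
  rw [hval] at h
  refine hasSum_of_forall_eq h fun k => ?_
  rw [jacobiPoly_eq_sum_antidiagonal, Finset.sum_mul]
  refine Finset.sum_congr rfl fun l hl => ?_
  have hl' : l ≤ k := by simpa [Nat.lt_succ_iff] using hl
  rw [mul_pow]
  conv_lhs => rw [← Nat.sub_add_cancel hl', pow_add, Nat.add_sub_cancel]
  ring

/-! ### Completely monotone sequences and the coefficients of the expansion -/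

/-- The backward difference `j ↦ f j - f (j + 1)` of a sequence. -/
def seqDiff (f : ℕ → ℝ) : ℕ → ℝ := fun j => f j - f (j + 1)

/-- Completely monotone sequences. -/
def IsCompletelyMonotone (f : ℕ → ℝ) : Prop := ∀ k j : ℕ, 0 ≤ seqDiff^[k] f j

theorem seqDiff_iterate_shift (f : ℕ → ℝ) (k j : ℕ) :
    seqDiff^[k] (fun i => f (i + 1)) j = seqDiff^[k] f (j + 1) := by
  induction k generalizing f with
  | zero => rfl
  | succ k ih => exact ih (seqDiff f)

theorem seqDiff_iterate_add (f g : ℕ → ℝ) (k j : ℕ) :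
    seqDiff^[k] (fun i => f i + g i) j = seqDiff^[k] f j + seqDiff^[k] g j := by
  induction k generalizing f g with
  | zero => rfl
  | succ k ih =>
    simp only [Function.iterate_succ, Function.comp]
    rw [← ih]
    refine congrFun (congrArg _ (funext fun i => ?_)) j
    simp only [seqDiff]; ring

theorem seqDiff_iterate_const_mul (c : ℝ) (f : ℕ → ℝ) (k j : ℕ) :
    seqDiff^[k] (fun i => c * f i) j = c * seqDiff^[k] f j := by
  induction k generalizing f with
  | zero => rfl
  | succ k ih =>
    simp only [Function.iterate_succ, Function.comp]
    rw [← ih]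
    refine congrFun (congrArg _ (funext fun i => ?_)) j
    simp only [seqDiff]; ring

/-- Leibniz rule `Δ(fg) = Δf · g + f(· + 1) · Δg`: both summands are again products of completely
monotone sequences, so induction on the order of the difference applies. -/
theorem IsCompletelyMonotone.mul {f g : ℕ → ℝ} (hf : IsCompletelyMonotone f)
    (hg : IsCompletelyMonotone g) : IsCompletelyMonotone (fun j => f j * g j) := by
  intro k
  induction k generalizing f g with
  | zero => exact fun j => mul_nonneg (hf 0 j) (hg 0 j)
  | succ k ih =>
    intro j
    have : seqDiff (fun j => f j * g j) =
        fun j => seqDiff f j * g j + f (j + 1) * seqDiff g j := by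
      ext j; simp only [seqDiff]; ring
    rw [Function.iterate_succ, Function.comp, this, seqDiff_iterate_add]
    refine add_nonneg (ih (f := seqDiff f) (fun k j => hf (k + 1) j) hg j)
      (ih (f := fun j => f (j + 1)) (g := seqDiff g) (fun k j => ?_) (fun k j => hg (k + 1) j) j)
    rw [seqDiff_iterate_shift]; exact hf k _

theorem IsCompletelyMonotone.seqDiff_iterate_le {f : ℕ → ℝ} (hf : IsCompletelyMonotone f)
    (k : ℕ) : seqDiff^[k] f 0 ≤ f 0 := by
  induction k with
  | zero => rfl
  | succ k ih =>
    refine le_trans ?_ ih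
    rw [Function.iterate_succ_apply']
    have := hf k 1
    simp only [seqDiff, zero_add]; linarith

/-- For `α < β` these are the moments of a beta distribution. The proof is algebraic: one difference
multiplies by `(β - α)/β ≥ 0` and replaces `β` by `β + 1`, whence an induction over all `β`. -/
theorem isCompletelyMonotone_poch_div {α β : ℝ} (hα : 0 < α) (hβ : α ≤ β) :
    IsCompletelyMonotone (fun j => poch α j / poch β j) := by
  intro k
  induction k generalizing β with
  | zero => exact fun j => div_nonneg (poch_pos hα j).le (poch_pos (hα.trans_le hβ) j).le
  | succ k ih =>
    intro j
    have hb : 0 < β := hα.trans_le hβ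
    have : seqDiff (fun j => poch α j / poch β j) =
        fun j => (β - α) / β * (poch α j / poch (β + 1) j) := by
      ext j
      have h1 : poch β (j + 1) = poch β j * (β + j) := poch_succ β j
      rw [poch_succ_left] at h1
      have h2 : poch (β + 1) j = poch β j * (β + j) / β := by
        rw [← h1]; field_simp
      have h3 := (poch_pos hb j).ne'
      have h4 : β + j ≠ 0 := by positivity
      simp only [seqDiff]
      rw [h2, poch_succ, poch_succ]
      field_simp; ring
    rw [Function.iterate_succ, Function.comp, this, seqDiff_iterate_const_mul]
    exact mul_nonneg (div_nonneg (by linarith) hb.le) (ih (by linarith) j)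

theorem seqDiff_iterate_eq_sum (f : ℕ → ℝ) (k : ℕ) :
    seqDiff^[k] f 0 = ∑ j ∈ Finset.range (k + 1), (-1) ^ j * (k.choose j : ℝ) * f j := by
  have h : ∀ k j, seqDiff^[k] f j = (-1) ^ k * (fwdDiff 1)^[k] f j := by
    intro k
    induction k with
    | zero => simp
    | succ k ih =>
      intro j
      rw [Function.iterate_succ_apply', Function.iterate_succ_apply', seqDiff, ih, ih, fwdDiff]
      ring
  rw [h, fwdDiff_iter_eq_sum_shift, Finset.mul_sum]
  refine Finset.sum_congr rfl fun j hj => ?_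
  have hj' : j ≤ k := by simpa [Nat.lt_succ_iff] using hj
  have : (-1 : ℝ) ^ k * (-1) ^ (k - j) = (-1) ^ j := by
    rw [← pow_add, show k + (k - j) = j + 2 * (k - j) by omega, pow_add, pow_mul]; simp
  simp only [zsmul_eq_mul, smul_eq_mul, mul_one, zero_add]
  push_cast
  rw [← this]; ring

theorem bincoef_neg_nat (k j : ℕ) : bincoef (-(k : ℝ)) j = (-1) ^ j * (k.choose j : ℝ) := by
  rw [bincoef_eq_choose, neg_neg, Ring.choose_natCast]

/-- The factor `(-k)_j / j! = (-1)^j (k choose j)` truncates the series and turns it into a `k`-th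
difference at the origin. -/
theorem coeffF_eq_sum (D m : ℝ) (n k : ℕ) :
    coeffF D m n k = ∑ j ∈ Finset.range (k + 1), (-1) ^ j * (k.choose j : ℝ) *
      (poch ((parA D m + n) / 2) j / poch (3 / 2 + n) j *
        (poch ((parA D m + n + 1) / 2) j / poch (parB D + 1 + n) j)) := by
  rw [coeffF, hyp3F2, tsum_eq_sum (s := Finset.range (k + 1))]
  · refine Finset.sum_congr rfl fun j _ => ?_
    rw [← bincoef_neg_nat, bincoef]
    simp only [one_pow, mul_one, div_eq_mul_inv, mul_inv]; ring
  · intro j hj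
    have hj' : k < j := by simpa using hj
    have h := bincoef_neg_nat k j
    rw [Nat.choose_eq_zero_of_lt hj', bincoef, Nat.cast_zero, mul_zero, div_eq_zero_iff] at h
    have : poch (-(k : ℝ)) j = 0 := h.resolve_right (by positivity)
    simp [this]

/-- The two upper parameters are paired with the two lower ones so that each ratio is completely
monotone: `a < 2` gives `(a + n)/2 ≤ 3/2 + n`, and `m > 0` gives `(a + n + 1)/2 ≤ b + 1 + n`.
Differences at the origin are bounded by the value there, which is 1. -/
theorem coeffF_mem_Icc {D m : ℝ} (hm : 0 < m) (ha : 0 < parA D m) (ha2 : parA D m < 2) (n k : ℕ) :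
    coeffF D m n k ∈ Icc (0 : ℝ) 1 := by
  have hn : (0 : ℝ) ≤ n := Nat.cast_nonneg n
  have hab : (parA D m + n + 1) / 2 ≤ parB D + 1 + n := by
    simp only [parA, parB]; linarith
  have h := (isCompletelyMonotone_poch_div (α := (parA D m + n) / 2) (β := 3 / 2 + n)
    (by linarith) (by linarith)).mul (isCompletelyMonotone_poch_div
      (α := (parA D m + n + 1) / 2) (by linarith) hab)
  rw [coeffF_eq_sum, ← seqDiff_iterate_eq_sum]
  refine ⟨h k 0, (h.seqDiff_iterate_le k).trans ?_⟩
  simp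

/-! ### Absolute convergence of the double series -/

theorem poch_half_div (n : ℕ) : poch (1 / 2) n / poch (3 / 2) n = 1 / (2 * n + 1) := by
  have h := poch_succ (1 / 2) n
  rw [poch_succ_left, show (1 : ℝ) / 2 + 1 = 3 / 2 by norm_num] at h
  have h1 : (0 : ℝ) < poch (3 / 2) n := poch_pos (by norm_num) n
  rw [div_eq_div_iff h1.ne' (by positivity)]
  linarith

/-- The terms behave like `n^(a-3)`. Asymptotics are avoided because the partial sums telescope to
`(2 - a)⁻¹ (1 - (a)_N / (N! (N + 1)))`. -/
theorem summable_bincoef_div {a : ℝ} (ha : 0 < a) (ha2 : a < 2) :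
    Summable (fun n : ℕ => bincoef a n / ((n + 1) * (n + 2))) := by
  have h0 : ∀ n, 0 ≤ bincoef a n := bincoef_nonneg ha
  have key : ∀ N, ∑ n ∈ Finset.range N, bincoef a n / (((n : ℝ) + 1) * (n + 2)) =
      (2 - a)⁻¹ * (1 - bincoef a N / (N + 1)) := by
    intro N
    have : 2 - a ≠ 0 := by linarith
    induction N with
    | zero => simp [bincoef]
    | succ N ih =>
      rw [Finset.sum_range_succ, ih]
      have : bincoef a (N + 1) = bincoef a N * (a + N) / (N + 1) := by
        rw [bincoef, bincoef, poch_succ, Nat.factorial_succ]; push_cast; field_simp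
      rw [this]; push_cast; field_simp; ring
  refine summable_of_sum_range_le (c := (2 - a)⁻¹) (fun n => ?_) fun N => ?_
  · exact div_nonneg (h0 n) (by positivity)
  · rw [key]
    have : 0 ≤ bincoef a N / (N + 1) := div_nonneg (h0 N) (by positivity)
    have h2 : 0 < (2 - a)⁻¹ := inv_pos.2 (by linarith)
    nlinarith

theorem summable_abs_coeffB {D m : ℝ} (hD : D < 4) (ha : 0 < parA D m) (ha2 : parA D m < 2) :
    Summable (fun n => |coeffB D m n|) := by
  have hb : -1 / 2 < parB D := by simp only [parB]; linarith
  set b := parB D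
  refine Summable.of_nonneg_of_le (fun _ => abs_nonneg _) (fun n => ?_)
    ((summable_bincoef_div ha ha2).mul_left (6 * |b| + 2))
  have e : coeffB D m n =
      poch (1 / 2) n / poch (3 / 2) n * (poch b n / poch (b + 1) n) * bincoef (parA D m) n := by
    rw [coeffB, bincoef]; simp only [div_eq_mul_inv, mul_inv]; ring
  -- The ratio is `b/(b + n)` for `n ≥ 1` and 1 for `n = 0`. The summand 2 covers `n = 0`; the
  -- factor 6 comes from `b > -1/2` and `n + 2 ≤ 6(n - 1/2)`.
  have h1 : |poch b n / poch (b + 1) n| ≤ (6 * |b| + 2) / (n + 2) := by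
    have h := poch_succ b n
    rw [poch_succ_left] at h
    have hp : 0 < poch (b + 1) n := poch_pos (by linarith) n
    rcases Nat.eq_zero_or_pos n with rfl | hn
    · simp only [poch_zero, div_one, abs_one, Nat.cast_zero, zero_add]
      linarith [abs_nonneg b]
    · have hn1 : (1 : ℝ) ≤ n := by exact_mod_cast hn
      have : 0 < b + n := by linarith
      have e2 : poch b n / poch (b + 1) n = b / (b + n) := by
        rw [div_eq_div_iff hp.ne' this.ne', h]
      rw [e2, abs_div, abs_of_pos this, div_le_div_iff₀ this (by positivity)]
      nlinarith [abs_nonneg b]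
  rw [e, abs_mul, abs_mul, poch_half_div, abs_of_nonneg (bincoef_nonneg ha n),
    abs_of_nonneg (by positivity : (0 : ℝ) ≤ 1 / (2 * n + 1))]
  have h2 : (1 : ℝ) / (2 * n + 1) ≤ 1 / (n + 1) :=
    one_div_le_one_div_of_le (by positivity) (by linarith [(Nat.cast_nonneg n : (0 : ℝ) ≤ n)])
  calc 1 / (2 * (n : ℝ) + 1) * |poch b n / poch (b + 1) n| * bincoef (parA D m) n
      ≤ 1 / (n + 1) * ((6 * |b| + 2) / (n + 2)) * bincoef (parA D m) n := by
        have := bincoef_nonneg ha n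
        gcongr
    _ = _ := by field_simp

theorem summable_coeffB_mul_coeffF {D m z : ℝ} (hD : D < 4) (hm : 0 < m) (ha : 0 < parA D m)
    (ha2 : parA D m < 2) (h0 : 0 ≤ z) (h1 : z < 1) :
    Summable (fun nk : ℕ × ℕ => coeffB D m nk.1 * coeffF D m nk.1 nk.2 * z ^ nk.2) := by
  have h := (summable_abs_coeffB hD ha ha2).mul_of_nonneg (summable_geometric_of_lt_one h0 h1)
    (fun _ => abs_nonneg _) (fun _ => by positivity)
  refine h.of_norm_bounded fun nk => ?_
  obtain ⟨f0, f1⟩ := coeffF_mem_Icc hm ha ha2 nk.1 nk.2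
  rw [Real.norm_eq_abs, abs_mul, abs_mul, abs_of_nonneg f0, abs_of_nonneg (pow_nonneg h0 _)]
  have : |coeffB D m nk.1| * coeffF D m nk.1 nk.2 ≤ |coeffB D m nk.1| := by
    nlinarith [abs_nonneg (coeffB D m nk.1)]
  exact mul_le_mul_of_nonneg_right this (pow_nonneg h0 _)

/-! ### Integration in continuous dimension as integration against a positive measure -/

/-- The density of the radial measure in dimension `ν ≠ 0`. -/
def radialWeight (ν r : ℝ) : ℝ :=
  2 * Real.pi ^ (ν / 2) / |Real.Gamma (ν / 2)| * r ^ (ν - 1)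

/-- The distribution of the length of a vector in a space of dimension `ν`. -/
def radialMeasure (ν : ℝ) : Measure ℝ :=
  if ν = 0 then Measure.dirac 0 else
    (volume.restrict (Ioi 0)).withDensity fun r => ENNReal.ofReal (radialWeight ν r)

/-- The function integrated against `radialMeasure ν` in `radialIntegral ν`. -/
def radialDiff (ν : ℝ) (g : ℝ → ℝ) (r : ℝ) : ℝ :=
  if 0 ≤ ν then g (r ^ 2) else g 0 - g (r ^ 2)

instance sigmaFinite_radialMeasure (ν : ℝ) : SigmaFinite (radialMeasure ν) := by
  unfold radialMeasure
  split_ifs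
  · infer_instance
  · exact SigmaFinite.withDensity_ofReal _

theorem measurable_radialWeight (ν : ℝ) : Measurable (radialWeight ν) := by
  unfold radialWeight; fun_prop

theorem radialWeight_nonneg (ν : ℝ) {r : ℝ} (hr : 0 ≤ r) : 0 ≤ radialWeight ν r := by
  unfold radialWeight; positivity

/-- For `-2 < ν < 0` one has `Γ(ν/2) < 0`. Its sign is absorbed by reversing the difference `g(r²) -
g(0)`, so the measure stays positive in every dimension. -/
theorem radialIntegral_eq_integral {ν : ℝ} (hν : -2 < ν) (g : ℝ → ℝ) :
    radialIntegral ν g = ∫ r, radialDiff ν g r ∂radialMeasure ν := by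
  have key : ∀ (h : ℝ → ℝ), ∫ r, h r ∂(volume.restrict (Ioi 0)).withDensity
      (fun r => ENNReal.ofReal (radialWeight ν r)) =
      2 * Real.pi ^ (ν / 2) / |Real.Gamma (ν / 2)| * ∫ r in Ioi (0 : ℝ), r ^ (ν - 1) * h r := by
    intro h
    rw [integral_withDensity_eq_integral_toReal_smul (measurable_radialWeight ν).ennreal_ofReal
      (Filter.Eventually.of_forall fun _ => ENNReal.ofReal_lt_top), ← integral_const_mul]
    refine setIntegral_congr_fun measurableSet_Ioi fun r hr => ?_
    simp only [smul_eq_mul]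
    rw [ENNReal.toReal_ofReal (radialWeight_nonneg ν (le_of_lt hr)), radialWeight, mul_assoc]
  rcases lt_trichotomy ν 0 with h | h | h
  · have h1 : Real.Gamma (ν / 2) < 0 := by
      have h2 := Real.Gamma_add_one (s := ν / 2) (by linarith)
      have h3 := Real.Gamma_pos_of_pos (s := ν / 2 + 1) (by linarith)
      nlinarith
    simp only [radialIntegral, radialMeasure, radialDiff, if_neg h.not_gt, if_neg h.ne,
      if_neg h.not_ge, key]
    rw [abs_of_neg h1, div_neg, neg_mul, ← mul_neg, ← integral_neg]
    congr 2
    ext r; ring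
  · subst h
    simp [radialIntegral, radialMeasure, radialDiff]
  · simp only [radialIntegral, radialMeasure, radialDiff, if_pos h, if_neg h.ne', if_pos h.le, key]
    rw [abs_of_pos (Real.Gamma_pos_of_pos (by linarith))]

/-- The measure on pairs (component along the fixed direction, transverse length). -/
def dimMeasure (D : ℝ) : Measure (ℝ × ℝ) := (volume : Measure ℝ).prod (radialMeasure (D - 1))

instance sigmaFinite_dimMeasure (D : ℝ) : SigmaFinite (dimMeasure D) := by
  unfold dimMeasure; infer_instance

/-- The function integrated against `dimMeasure D` in `dimIntegral D`. -/
def dimDiff (D : ℝ) (f : ℝ → ℝ → ℝ) (z : ℝ × ℝ) : ℝ := radialDiff (D - 1) (f z.1) z.2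

theorem dimIntegral_eq_integral {D : ℝ} (hD : 0 < D) {f : ℝ → ℝ → ℝ}
    (hf : Integrable (dimDiff D f) (dimMeasure D)) :
    dimIntegral D f = ∫ z, dimDiff D f z ∂dimMeasure D := by
  unfold dimMeasure at hf ⊢
  rw [integral_prod _ hf, dimIntegral]
  congr 1
  ext x
  exact radialIntegral_eq_integral (by linarith) _

/-- The indicator function of `{K | K < N}`. -/
def ballInd (N K : ℝ) : ℝ := if K < N then 1 else 0

theorem measurable_ballInd : Measurable fun z : ℝ × ℝ => ballInd z.1 z.2 := by
  unfold ballInd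
  exact Measurable.ite (measurableSet_lt measurable_snd measurable_fst) measurable_const
    measurable_const

theorem radialDiff_nonneg {ν : ℝ} {g : ℝ → ℝ} (h0 : ∀ u, 0 ≤ u → 0 ≤ g u)
    (h1 : ∀ u, 0 ≤ u → g u ≤ g 0) (r : ℝ) : 0 ≤ radialDiff ν g r := by
  unfold radialDiff
  split_ifs
  · exact h0 _ (sq_nonneg r)
  · exact sub_nonneg.2 (h1 _ (sq_nonneg r))

/-! ### Volumes of balls in continuous dimension and beta integrals -/

theorem lintegral_radialMeasure {ν : ℝ} (hν : ν ≠ 0) {g : ℝ → ENNReal} (hg : Measurable g) :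
    ∫⁻ r, g r ∂radialMeasure ν = ∫⁻ r in Ioi 0, ENNReal.ofReal (radialWeight ν r) * g r := by
  rw [radialMeasure, if_neg hν, lintegral_withDensity_eq_lintegral_mul _
    (measurable_radialWeight ν).ennreal_ofReal hg]
  rfl

/-- The volume of the `ν`-ball of squared radius `N`, by one formula for all signs of `ν`. For `ν <
0` the reversed difference is the indicator of the outside `r ≥ √N`, and the sign from `∫ r^(ν-1)`
cancels the one in `Γ(ν/2 + 1) = (ν/2) Γ(ν/2)`. -/
theorem lintegral_radialDiff_ballInd {ν : ℝ} (hν : -2 < ν) (N : ℝ) :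
    ∫⁻ r, ENNReal.ofReal (radialDiff ν (ballInd N) r) ∂radialMeasure ν =
      ENNReal.ofReal (if 0 < N then Real.pi ^ (ν / 2) / Real.Gamma (ν / 2 + 1) * N ^ (ν / 2)
        else 0) := by
  have hmeas : Measurable fun r => ENNReal.ofReal (radialDiff ν (ballInd N) r) := by
    have h : Measurable (ballInd N) := measurable_ballInd.comp (measurable_const.prodMk measurable_id)
    unfold radialDiff
    split_ifs <;> fun_prop
  by_cases hN : 0 < N
  swap
  · rw [if_neg hN]
    have : ∀ r, radialDiff ν (ballInd N) r = 0 := by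
      intro r
      have h1 : ¬ r ^ 2 < N := not_lt.2 ((not_lt.1 hN).trans (sq_nonneg r))
      simp [radialDiff, ballInd, h1, hN]
    simp [this]
  rw [if_pos hN]
  have hs : 0 < Real.sqrt N := Real.sqrt_pos.2 hN
  have hpow : Real.sqrt N ^ ν = N ^ (ν / 2) := by
    rw [Real.sqrt_eq_rpow, ← Real.rpow_mul hN.le]; congr 1; ring
  have hiff : ∀ r : ℝ, 0 < r → (r ^ 2 < N ↔ r < Real.sqrt N) := fun r hr =>
    (Real.lt_sqrt hr.le).symm
  rcases lt_trichotomy ν 0 with h | h | h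
  · have hg : Real.Gamma (ν / 2 + 1) = ν / 2 * Real.Gamma (ν / 2) :=
      Real.Gamma_add_one (by linarith)
    have h3 := Real.Gamma_pos_of_pos (s := ν / 2 + 1) (by linarith)
    have h1 : Real.Gamma (ν / 2) < 0 := by nlinarith
    rw [lintegral_radialMeasure h.ne hmeas]
    have e1 : ∫⁻ r in Ioi 0, ENNReal.ofReal (radialWeight ν r) *
        ENNReal.ofReal (radialDiff ν (ballInd N) r) =
        ∫⁻ r in Ioi 0, (Ici (Real.sqrt N)).indicator
          (fun r => ENNReal.ofReal (radialWeight ν r)) r := by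
      refine setLIntegral_congr_fun measurableSet_Ioi fun r hr => ?_
      simp only [radialDiff, if_neg h.not_ge, ballInd, if_pos hN, hiff r hr, indicator, mem_Ici]
      by_cases hr2 : r < Real.sqrt N
      · simp [hr2]
      · simp [hr2, not_lt.1 hr2]
    have e2 : Ici (Real.sqrt N) ∩ Ioi 0 = Ici (Real.sqrt N) :=
      inter_eq_left.2 fun r hr => hs.trans_le hr
    rw [e1, lintegral_indicator measurableSet_Ici, Measure.restrict_restrict measurableSet_Ici, e2,
      setLIntegral_congr Ioi_ae_eq_Ici.symm, ← ofReal_integral_eq_lintegral_ofReal]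
    · simp only [radialWeight]
      rw [integral_const_mul, integral_Ioi_rpow_of_lt (by linarith) hs, abs_of_neg h1, hg,
        sub_add_cancel, hpow]
      congr 1
      have := h.ne
      have := h1.ne
      field_simp
    · exact (integrableOn_Ioi_rpow_of_lt (by linarith) hs).const_mul _
    · filter_upwards [ae_restrict_mem measurableSet_Ioi] with r hr
      exact radialWeight_nonneg ν (hs.trans hr).le
  · subst h
    simp [radialMeasure, radialDiff, ballInd, hN]
  · have hg : Real.Gamma (ν / 2 + 1) = ν / 2 * Real.Gamma (ν / 2) :=
      Real.Gamma_add_one (by linarith)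
    have h1 := Real.Gamma_pos_of_pos (s := ν / 2) (by linarith)
    rw [lintegral_radialMeasure h.ne' hmeas]
    have e1 : ∫⁻ r in Ioi 0, ENNReal.ofReal (radialWeight ν r) *
        ENNReal.ofReal (radialDiff ν (ballInd N) r) =
        ∫⁻ r in Ioi 0, (Iio (Real.sqrt N)).indicator
          (fun r => ENNReal.ofReal (radialWeight ν r)) r := by
      refine setLIntegral_congr_fun measurableSet_Ioi fun r hr => ?_
      simp only [radialDiff, if_pos h.le, ballInd, hiff r hr, indicator, mem_Iio]
      by_cases hr2 : r < Real.sqrt N <;> simp [hr2]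
    have e2 : Iio (Real.sqrt N) ∩ Ioi 0 = Ioo 0 (Real.sqrt N) := by
      rw [inter_comm]; rfl
    rw [e1, lintegral_indicator measurableSet_Iio, Measure.restrict_restrict measurableSet_Iio, e2,
      setLIntegral_congr Ioo_ae_eq_Ioc, ← ofReal_integral_eq_lintegral_ofReal]
    · simp only [radialWeight]
      rw [integral_const_mul, ← intervalIntegral.integral_of_le hs.le,
        integral_rpow (Or.inl (by linarith)), abs_of_pos h1, hg,
        sub_add_cancel, hpow, Real.zero_rpow h.ne']
      congr 1
      have := h.ne'
      have := h1.ne'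
      field_simp
      ring
    · exact ((intervalIntegral.intervalIntegrable_rpow' (by linarith)).1).const_mul _
    · filter_upwards [ae_restrict_mem measurableSet_Ioc] with r hr
      exact radialWeight_nonneg ν hr.1.le

theorem lintegral_beta {α β : ℝ} (hα : 0 < α) (hβ : 0 < β) :
    ∫⁻ t in Ioo (0 : ℝ) 1, ENNReal.ofReal (t ^ (α - 1) * (1 - t) ^ (β - 1)) =
      ENNReal.ofReal (ProbabilityTheory.beta α β) := by
  have h := ProbabilityTheory.lintegral_betaPDF_eq_one hα hβ
  have hb := ProbabilityTheory.beta_pos hα hβ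
  rw [ProbabilityTheory.lintegral_betaPDF] at h
  simp_rw [mul_assoc] at h
  simp_rw [ENNReal.ofReal_mul (one_div_pos.2 hb).le] at h
  rw [lintegral_const_mul' _ _ ENNReal.ofReal_ne_top] at h
  calc _ = ENNReal.ofReal (ProbabilityTheory.beta α β) * (ENNReal.ofReal
        (1 / ProbabilityTheory.beta α β) * ∫⁻ t in Ioo (0 : ℝ) 1,
          ENNReal.ofReal (t ^ (α - 1) * (1 - t) ^ (β - 1))) := by
        rw [← mul_assoc, ← ENNReal.ofReal_mul hb.le, mul_one_div_cancel hb.ne',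
          ENNReal.ofReal_one, one_mul]
    _ = _ := by rw [h, mul_one]

theorem lintegral_eq_two_mul_of_even {g : ℝ → ENNReal} (hg : ∀ x, g (-x) = g x) :
    ∫⁻ x, g x = 2 * ∫⁻ x in Ioi (0 : ℝ), g x := by
  rw [← lintegral_add_compl g (measurableSet_Ioi (a := (0 : ℝ))), compl_Ioi, two_mul,
    setLIntegral_congr Iio_ae_eq_Iic.symm]
  congr 1
  have h : (fun x : ℝ => -x) '' Ioi 0 = Iio 0 := by simp
  rw [← h, lintegral_image_eq_lintegral_abs_deriv_mul measurableSet_Ioi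
    (fun x _ => (hasDerivAt_neg x).hasDerivWithinAt) neg_injective.injOn]
  simp [hg]

/-- Integrates the volumes of the transverse slices of a ball; `x = √M √t` on the positive half
makes it a beta integral. -/
theorem lintegral_pow_mul_ball (n : ℕ) {ν M : ℝ} (hν : -2 < ν) (hM : 0 < M) :
    ∫⁻ x : ℝ, ENNReal.ofReal (x ^ (2 * n) * if 0 < M - x ^ 2 then (M - x ^ 2) ^ (ν / 2) else 0) =
      ENNReal.ofReal (ProbabilityTheory.beta (n + 1 / 2) (ν / 2 + 1) *
        M ^ (n + ν / 2 + 1 / 2)) := by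
  rw [lintegral_eq_two_mul_of_even (fun x => by rw [Even.neg_pow ⟨n, by ring⟩, neg_sq])]
  have hs : 0 < Real.sqrt M := Real.sqrt_pos.2 hM
  have hsq : Real.sqrt M ^ 2 = M := Real.sq_sqrt hM.le
  have e1 : ∫⁻ x in Ioi (0 : ℝ), ENNReal.ofReal (x ^ (2 * n) *
        if 0 < M - x ^ 2 then (M - x ^ 2) ^ (ν / 2) else 0) =
      ∫⁻ x in Ioo (0 : ℝ) (Real.sqrt M),
        ENNReal.ofReal (x ^ (2 * n) * (M - x ^ 2) ^ (ν / 2)) := by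
    have : Ioo (0 : ℝ) (Real.sqrt M) = Iio (Real.sqrt M) ∩ Ioi 0 := by rw [inter_comm]; rfl
    rw [this, ← Measure.restrict_restrict measurableSet_Iio, ← lintegral_indicator measurableSet_Iio]
    refine setLIntegral_congr_fun measurableSet_Ioi fun x hx => ?_
    have : 0 < M - x ^ 2 ↔ x < Real.sqrt M := by
      rw [Real.lt_sqrt (le_of_lt hx), sub_pos]
    simp only [this, indicator, mem_Iio]
    split_ifs <;> simp
  have himg : (fun t : ℝ => Real.sqrt M * Real.sqrt t) '' Ioo 0 1 = Ioo 0 (Real.sqrt M) := by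
    ext x
    constructor
    · rintro ⟨t, ⟨h0, h1⟩, rfl⟩
      have := Real.sqrt_pos.2 h0
      have : Real.sqrt t < 1 := by rw [Real.sqrt_lt' one_pos]; simpa using h1
      constructor
      · positivity
      · nlinarith
    · rintro ⟨h0, h1⟩
      refine ⟨(x / Real.sqrt M) ^ 2, ⟨by positivity, ?_⟩, ?_⟩
      · rw [sq_lt_one_iff₀ (by positivity), div_lt_one hs]; exact h1
      · simp only
        rw [Real.sqrt_sq (by positivity)]; field_simp
  rw [e1, ← himg, lintegral_image_eq_lintegral_abs_deriv_mul measurableSet_Ioo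
    (f' := fun t => Real.sqrt M * (1 / (2 * Real.sqrt t)))
    (fun t ht => ((Real.hasDerivAt_sqrt ht.1.ne').const_mul _).hasDerivWithinAt)
    (fun s hs' t ht h => by
      have h2 := mul_left_cancel₀ hs.ne' h
      exact (Real.sqrt_inj hs'.1.le ht.1.le).1 h2)]
  have hb := lintegral_beta (α := n + 1 / 2) (β := ν / 2 + 1) (by positivity) (by linarith)
  have e2 : ∀ t ∈ Ioo (0 : ℝ) 1, ENNReal.ofReal |Real.sqrt M * (1 / (2 * Real.sqrt t))| *
      ENNReal.ofReal ((Real.sqrt M * Real.sqrt t) ^ (2 * n) *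
        (M - (Real.sqrt M * Real.sqrt t) ^ 2) ^ (ν / 2)) =
      ENNReal.ofReal (M ^ (n + ν / 2 + 1 / 2) / 2) *
        ENNReal.ofReal (t ^ ((n : ℝ) + 1 / 2 - 1) * (1 - t) ^ (ν / 2 + 1 - 1)) := by
    intro t ⟨h0, h1⟩
    have hst := Real.sqrt_pos.2 h0
    rw [abs_of_pos (by positivity), ← ENNReal.ofReal_mul (by positivity),
      ← ENNReal.ofReal_mul (by positivity)]
    congr 1
    rw [mul_pow, mul_pow, hsq, Real.sq_sqrt h0.le, pow_mul, pow_mul, hsq, Real.sq_sqrt h0.le,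
      show M - M * t = M * (1 - t) by ring, Real.mul_rpow hM.le (by linarith),
      show (n : ℝ) + ν / 2 + 1 / 2 = n + (ν / 2 + 1 / 2) by ring, Real.rpow_add hM,
      Real.rpow_add hM, Real.rpow_natCast, show (n : ℝ) + 1 / 2 - 1 = n + -(1 / 2) by ring,
      Real.rpow_add h0, Real.rpow_natCast, Real.rpow_neg h0.le, ← Real.sqrt_eq_rpow,
      ← Real.sqrt_eq_rpow, add_sub_cancel_right]
    field_simp
  rw [setLIntegral_congr_fun measurableSet_Ioo e2, lintegral_const_mul' _ _ ENNReal.ofReal_ne_top,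
    hb, ← ENNReal.ofReal_mul (by positivity), show (2 : ENNReal) = ENNReal.ofReal 2 by simp,
    ← ENNReal.ofReal_mul (by positivity)]
  congr 1; ring

theorem lintegral_dimMeasure {D : ℝ} {g : ℝ × ℝ → ENNReal} (hg : Measurable g) :
    ∫⁻ z, g z ∂dimMeasure D = ∫⁻ x, ∫⁻ r, g (x, r) ∂radialMeasure (D - 1) :=
  lintegral_prod _ hg.aemeasurable

theorem lintegral_dimMeasure_shift {D : ℝ} {g : ℝ × ℝ → ENNReal} (hg : Measurable g) (c : ℝ) :
    ∫⁻ z, g (z.1 + c, z.2) ∂dimMeasure D = ∫⁻ z, g z ∂dimMeasure D := by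
  rw [lintegral_dimMeasure hg, lintegral_dimMeasure (g := fun z => g (z.1 + c, z.2)) (by fun_prop)]
  exact lintegral_add_right_eq_self (fun x => ∫⁻ r, g (x, r) ∂radialMeasure (D - 1)) c

theorem measurable_dimDiff {Ω : Type*} [MeasurableSpace Ω] {D : ℝ} {f : Ω → ℝ → ℝ → ℝ}
    (hf : Measurable fun p : Ω × ℝ × ℝ => f p.1 p.2.1 p.2.2) :
    Measurable fun p : Ω × ℝ × ℝ => dimDiff D (f p.1) p.2 := by
  have h1 : Measurable fun p : Ω × ℝ × ℝ => f p.1 p.2.1 (p.2.2 ^ 2) :=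
    hf.comp (measurable_fst.prodMk ((measurable_fst.comp measurable_snd).prodMk
      ((measurable_snd.comp measurable_snd).pow_const 2)))
  have h2 : Measurable fun p : Ω × ℝ × ℝ => f p.1 p.2.1 0 :=
    hf.comp (measurable_fst.prodMk ((measurable_fst.comp measurable_snd).prodMk measurable_const))
  unfold dimDiff radialDiff
  split_ifs
  · exact h1
  · exact h2.sub h1

theorem measurable_dimDiff' {D : ℝ} {f : ℝ → ℝ → ℝ} (hf : Measurable fun p : ℝ × ℝ => f p.1 p.2) :
    Measurable (dimDiff D f) :=
  (measurable_dimDiff (Ω := Unit) (f := fun _ => f) (hf.comp measurable_snd)).comp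
    (measurable_const.prodMk measurable_id : Measurable fun z : ℝ × ℝ => ((), z))

theorem dimDiff_mul_left (D : ℝ) (c : ℝ → ℝ) (f : ℝ → ℝ → ℝ) (z : ℝ × ℝ) :
    dimDiff D (fun x u => c x * f x u) z = c z.1 * dimDiff D f z := by
  unfold dimDiff radialDiff
  split_ifs
  · rfl
  · ring

/-- A decreasing differentiable profile on the half line which vanishes at infinity. -/
structure IsProfile (h η : ℝ → ℝ) : Prop where
  measurable : Measurable h
  measurable_deriv : Measurable η
  deriv_nonneg : ∀ x, 0 ≤ x → 0 ≤ η x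
  hasDerivAt : ∀ x, 0 ≤ x → HasDerivAt h (-(η x)) x
  tendsto : Filter.Tendsto h Filter.atTop (nhds 0)

namespace IsProfile

variable {h η : ℝ → ℝ}

theorem integral_Ioi (H : IsProfile h η) {K : ℝ} (hK : 0 ≤ K) :
    IntegrableOn η (Ioi K) ∧ ∫ M in Ioi K, η M = h K := by
  have h1 : ∀ x ∈ Ici K, HasDerivAt h (-(η x)) x := fun x hx => H.hasDerivAt x (hK.trans hx)
  have h2 : ∀ x ∈ Ioi K, -(η x) ≤ 0 := fun x hx =>
    neg_nonpos.2 (H.deriv_nonneg x (hK.trans (le_of_lt hx)))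
  constructor
  · simpa using (integrableOn_Ioi_deriv_of_nonpos' h1 h2 H.tendsto).neg
  · have := integral_Ioi_of_hasDerivAt_of_nonpos' h1 h2 H.tendsto
    rw [integral_neg] at this
    linarith

/-- A profile is a superposition of ball indicators with nonnegative weights `η`, so integrals of
profiles reduce to volumes of balls. -/
theorem layer_cake (H : IsProfile h η) {K : ℝ} (hK : 0 ≤ K) :
    IntegrableOn (fun M => η M * ballInd M K) (Ioi 0) ∧
      ∫ M in Ioi 0, η M * ballInd M K = h K := by
  obtain ⟨h1, h2⟩ := H.integral_Ioi hK
  have e : (fun M => η M * ballInd M K) = (Ioi K).indicator η := by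
    ext M
    simp only [ballInd, indicator, mem_Ioi]
    split_ifs <;> simp
  have e2 : Ioi K ∩ Ioi 0 = Ioi K := inter_eq_left.2 (Ioi_subset_Ioi hK)
  rw [e]
  constructor
  · rw [IntegrableOn, integrable_indicator_iff measurableSet_Ioi, IntegrableOn,
      Measure.restrict_restrict measurableSet_Ioi, e2]
    exact h1
  · rw [integral_indicator measurableSet_Ioi, Measure.restrict_restrict measurableSet_Ioi, e2, h2]

theorem ofReal_eq_lintegral (H : IsProfile h η) {K : ℝ} (hK : 0 ≤ K) :
    ENNReal.ofReal (h K) = ∫⁻ M in Ioi 0, ENNReal.ofReal (η M * ballInd M K) := by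
  obtain ⟨h1, h2⟩ := H.layer_cake hK
  rw [← h2, ofReal_integral_eq_lintegral_ofReal h1]
  filter_upwards [ae_restrict_mem measurableSet_Ioi] with M hM
  refine mul_nonneg (H.deriv_nonneg M (le_of_lt hM)) ?_
  unfold ballInd; split_ifs <;> norm_num

theorem nonneg (H : IsProfile h η) {K : ℝ} (hK : 0 ≤ K) : 0 ≤ h K := by
  rw [← (H.integral_Ioi hK).2]
  exact setIntegral_nonneg measurableSet_Ioi fun M hM =>
    H.deriv_nonneg M (hK.trans (le_of_lt hM))

theorem antitone (H : IsProfile h η) {K L : ℝ} (hK : 0 ≤ K) (hKL : K ≤ L) : h L ≤ h K := by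
  rw [← (H.integral_Ioi hK).2, ← (H.integral_Ioi (hK.trans hKL)).2]
  refine setIntegral_mono_set (H.integral_Ioi hK).1 ?_ (Ioi_subset_Ioi hKL).eventuallyLE
  filter_upwards [ae_restrict_mem measurableSet_Ioi] with M hM
  exact H.deriv_nonneg M (hK.trans (le_of_lt hM))

theorem radialDiff_nonneg (H : IsProfile h η) (ν x r : ℝ) :
    0 ≤ radialDiff ν (fun u => h (x ^ 2 + u)) r :=
  Lifshitz.radialDiff_nonneg (fun u hu => H.nonneg (by positivity))
    (fun u hu => H.antitone (by positivity) (by linarith)) r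

theorem ofReal_radialDiff (H : IsProfile h η) (ν x r : ℝ) :
    ENNReal.ofReal (radialDiff ν (fun u => h (x ^ 2 + u)) r) =
      ∫⁻ M in Ioi 0, ENNReal.ofReal (η M) *
        ENNReal.ofReal (radialDiff ν (ballInd (M - x ^ 2)) r) := by
  have hb : ∀ M u, ballInd (M - x ^ 2) u = ballInd M (x ^ 2 + u) := by
    intro M u
    simp only [ballInd, lt_sub_iff_add_lt, add_comm u]
  have hb0 : ∀ M r, 0 ≤ radialDiff ν (ballInd (M - x ^ 2)) r := fun M r =>
    Lifshitz.radialDiff_nonneg (fun u _ => by unfold ballInd; split_ifs <;> norm_num)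
      (fun u hu => by
        unfold ballInd
        split_ifs with h1 h2
        · rfl
        · exact absurd (hu.trans_lt h1) h2
        · norm_num
        · rfl) r
  have hx : 0 ≤ x ^ 2 := sq_nonneg x
  obtain ⟨i1, v1⟩ := H.layer_cake (add_nonneg hx (sq_nonneg r))
  obtain ⟨i0, v0⟩ := H.layer_cake (add_nonneg hx le_rfl)
  -- The subtraction occurring for `ν < 0` is carried out in `ℝ`, where both layer integrals are
  -- finite; only the nonnegative result passes to `ENNReal`.
  have hreal : IntegrableOn (fun M => η M * radialDiff ν (ballInd (M - x ^ 2)) r) (Ioi 0) ∧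
      ∫ M in Ioi 0, η M * radialDiff ν (ballInd (M - x ^ 2)) r =
        radialDiff ν (fun u => h (x ^ 2 + u)) r := by
    unfold radialDiff
    split_ifs
    · simp only [hb]
      exact ⟨i1, v1⟩
    · simp only [hb, mul_sub]
      refine ⟨i0.sub i1, ?_⟩
      rw [integral_sub i0 i1, v0, v1]
  rw [← hreal.2, ofReal_integral_eq_lintegral_ofReal hreal.1]
  · refine setLIntegral_congr_fun measurableSet_Ioi fun M hM => ?_
    exact ENNReal.ofReal_mul (H.deriv_nonneg M (le_of_lt hM))
  · filter_upwards [ae_restrict_mem measurableSet_Ioi] with M hM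
    exact mul_nonneg (H.deriv_nonneg M (le_of_lt hM)) (hb0 M r)

/-- Integration by parts without boundary terms: write `M^s` as `s ∫ K^(s-1)` over `(0, M)`,
exchange the integrals by Tonelli and resum the layers. -/
theorem lintegral_rpow_mul (H : IsProfile h η) {s : ℝ} (hs : 0 < s) :
    ∫⁻ M in Ioi 0, ENNReal.ofReal (η M) * ENNReal.ofReal (M ^ s) =
      ENNReal.ofReal s * ∫⁻ K in Ioi 0, ENNReal.ofReal (K ^ (s - 1) * h K) := by
  have e1 : ∀ M ∈ Ioi (0 : ℝ), ENNReal.ofReal (η M) * ENNReal.ofReal (M ^ s) =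
      ∫⁻ K in Ioi 0, ENNReal.ofReal s *
        (ENNReal.ofReal (K ^ (s - 1)) * ENNReal.ofReal (η M * ballInd M K)) := by
    intro M hM
    have hM' : (0 : ℝ) < M := hM
    have e : ∀ K ∈ Ioi (0 : ℝ), ENNReal.ofReal s *
        (ENNReal.ofReal (K ^ (s - 1)) * ENNReal.ofReal (η M * ballInd M K)) =
        ENNReal.ofReal (η M) * (Iio M).indicator (fun K => ENNReal.ofReal (s * K ^ (s - 1))) K := by
      intro K hK
      have hK' : (0 : ℝ) < K := hK
      simp only [ballInd, indicator, mem_Iio]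
      split_ifs
      · rw [mul_one, ENNReal.ofReal_mul hs.le]; ring
      · simp
    have e2 : Iio M ∩ Ioi 0 = Ioo 0 M := by rw [inter_comm]; rfl
    rw [setLIntegral_congr_fun measurableSet_Ioi e, lintegral_const_mul' _ _ ENNReal.ofReal_ne_top,
      lintegral_indicator measurableSet_Iio, Measure.restrict_restrict measurableSet_Iio, e2,
      setLIntegral_congr Ioo_ae_eq_Ioc, ← ofReal_integral_eq_lintegral_ofReal]
    · rw [integral_const_mul, ← intervalIntegral.integral_of_le hM'.le,
        integral_rpow (Or.inl (by linarith)), sub_add_cancel, Real.zero_rpow hs.ne']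
      congr 2
      field_simp; ring
    · exact ((intervalIntegral.intervalIntegrable_rpow' (by linarith)).1).const_mul _
    · filter_upwards [ae_restrict_mem measurableSet_Ioc] with K hK
      have : 0 < K := hK.1
      simp only [Pi.zero_apply]
      positivity
  rw [setLIntegral_congr_fun measurableSet_Ioi e1, lintegral_lintegral_swap]
  · rw [← lintegral_const_mul' _ _ ENNReal.ofReal_ne_top]
    refine setLIntegral_congr_fun measurableSet_Ioi fun K hK => ?_
    have hK' : (0 : ℝ) < K := hK
    rw [lintegral_const_mul' _ _ ENNReal.ofReal_ne_top,
      lintegral_const_mul' _ _ ENNReal.ofReal_ne_top, ← H.ofReal_eq_lintegral hK'.le,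
      ENNReal.ofReal_mul (by positivity)]
  · have h1 := measurable_ballInd
    have h2 := H.measurable_deriv
    refine Measurable.aemeasurable ?_
    unfold Function.uncurry
    fun_prop

/-- Integration of a radial profile, with an even power of one coordinate, over a space of
continuous dimension. -/
theorem lintegral_dimDiff (H : IsProfile h η) {D : ℝ} (hD : 0 < D) (n : ℕ) (c : ℝ) :
    ∫⁻ z, ENNReal.ofReal ((z.1 + c) ^ (2 * n) *
        dimDiff D (fun x u => h ((x + c) ^ 2 + u)) z) ∂dimMeasure D =
      ENNReal.ofReal (Real.pi ^ ((D - 1) / 2) * Real.Gamma (n + 1 / 2) / Real.Gamma (D / 2 + n)) *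
        ∫⁻ K in Ioi 0, ENNReal.ofReal (K ^ (D / 2 + n - 1) * h K) := by
  have hmeas := H.measurable
  have hmeas' := H.measurable_deriv
  have hpow : ∀ x : ℝ, 0 ≤ x ^ (2 * n) := fun x => by rw [pow_mul]; positivity
  have hm0 : Measurable (dimDiff D (fun x u => h (x ^ 2 + u))) :=
    measurable_dimDiff' (by fun_prop)
  have hshift := lintegral_dimMeasure_shift (D := D) (g := fun z => ENNReal.ofReal (z.1 ^ (2 * n) *
    dimDiff D (fun x u => h (x ^ 2 + u)) z)) (by fun_prop) c
  refine Eq.trans hshift ?_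
  have hball : Measurable fun p : ℝ × ℝ × ℝ =>
      dimDiff D (fun x u => ballInd (p.1 - x ^ 2) u) p.2 := by
    refine measurable_dimDiff (Ω := ℝ) (f := fun M x u => ballInd (M - x ^ 2) u) ?_
    exact measurable_ballInd.comp (by fun_prop : Measurable fun p : ℝ × ℝ × ℝ =>
      (p.1 - p.2.1 ^ 2, p.2.2))
  have hball' : Measurable fun p : (ℝ × ℝ) × ℝ =>
      dimDiff D (fun x u => ballInd (p.2 - x ^ 2) u) p.1 := hball.comp measurable_swap
  have e1 : ∀ z : ℝ × ℝ, ENNReal.ofReal (z.1 ^ (2 * n) *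
      dimDiff D (fun x u => h (x ^ 2 + u)) z) = ∫⁻ M in Ioi 0, ENNReal.ofReal (z.1 ^ (2 * n)) *
        (ENNReal.ofReal (η M) *
        ENNReal.ofReal (dimDiff D (fun x u => ballInd (M - x ^ 2) u) z)) := by
    intro z
    rw [ENNReal.ofReal_mul (hpow _), lintegral_const_mul' _ _ ENNReal.ofReal_ne_top]
    congr 1
    exact H.ofReal_radialDiff (D - 1) z.1 z.2
  simp_rw [e1]
  rw [lintegral_lintegral_swap (by
    refine Measurable.aemeasurable ?_
    unfold Function.uncurry
    fun_prop)]
  have e2 : ∀ M ∈ Ioi (0 : ℝ), ∫⁻ z, ENNReal.ofReal (z.1 ^ (2 * n)) * (ENNReal.ofReal (η M) *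
        ENNReal.ofReal (dimDiff D (fun x u => ballInd (M - x ^ 2) u) z)) ∂dimMeasure D =
      ENNReal.ofReal (Real.pi ^ ((D - 1) / 2) / Real.Gamma ((D - 1) / 2 + 1) *
        ProbabilityTheory.beta (n + 1 / 2) ((D - 1) / 2 + 1)) *
        (ENNReal.ofReal (η M) * ENNReal.ofReal (M ^ (D / 2 + n))) := by
    intro M hM
    have hG : 0 < Real.Gamma ((D - 1) / 2 + 1) := Real.Gamma_pos_of_pos (by linarith)
    have hcn : 0 ≤ Real.pi ^ ((D - 1) / 2) / Real.Gamma ((D - 1) / 2 + 1) :=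
      div_nonneg (by positivity) hG.le
    have hbM : Measurable (dimDiff D (fun x u => ballInd (M - x ^ 2) u)) :=
      hball.comp (measurable_const.prodMk measurable_id : Measurable fun z : ℝ × ℝ => (M, z))
    rw [lintegral_dimMeasure (by fun_prop)]
    have e3 : ∀ x : ℝ, ∫⁻ r, ENNReal.ofReal (x ^ (2 * n)) * (ENNReal.ofReal (η M) *
        ENNReal.ofReal (dimDiff D (fun x u => ballInd (M - x ^ 2) u) (x, r)))
          ∂radialMeasure (D - 1) =
        (ENNReal.ofReal (η M) *
        ENNReal.ofReal (Real.pi ^ ((D - 1) / 2) / Real.Gamma ((D - 1) / 2 + 1))) *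
        ENNReal.ofReal (x ^ (2 * n) *
          if 0 < M - x ^ 2 then (M - x ^ 2) ^ ((D - 1) / 2) else 0) := by
      intro x
      rw [lintegral_const_mul' _ _ ENNReal.ofReal_ne_top,
        lintegral_const_mul' _ _ ENNReal.ofReal_ne_top]
      simp only [dimDiff]
      rw [lintegral_radialDiff_ballInd (by linarith), ENNReal.ofReal_mul (hpow x), mul_left_comm,
        mul_assoc]
      congr 1
      rw [mul_left_comm, ← ENNReal.ofReal_mul hcn]
      congr 2
      split_ifs <;> simp
    simp_rw [e3]
    rw [lintegral_const_mul' _ _ (ENNReal.mul_ne_top ENNReal.ofReal_ne_top ENNReal.ofReal_ne_top),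
      lintegral_pow_mul_ball n (by linarith) hM,
      show (n : ℝ) + (D - 1) / 2 + 1 / 2 = D / 2 + n by ring,
      ENNReal.ofReal_mul (ProbabilityTheory.beta_pos (by positivity) (by linarith)).le,
      ENNReal.ofReal_mul (p := Real.pi ^ ((D - 1) / 2) / _) hcn]
    ring
  -- Resumming the layers produces the factor `D/2 + n`, which cancels against `Γ(D/2 + n + 1)` in
  -- the beta function.
  rw [setLIntegral_congr_fun measurableSet_Ioi e2, lintegral_const_mul' _ _ ENNReal.ofReal_ne_top,
    H.lintegral_rpow_mul (by positivity), ← mul_assoc, ← ENNReal.ofReal_mul' (by positivity)]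
  congr 2
  have hG : 0 < Real.Gamma ((D - 1) / 2 + 1) := Real.Gamma_pos_of_pos (by linarith)
  have hG2 : 0 < Real.Gamma (D / 2 + n) := Real.Gamma_pos_of_pos (by positivity)
  rw [ProbabilityTheory.beta, show (n : ℝ) + 1 / 2 + ((D - 1) / 2 + 1) = D / 2 + n + 1 by ring,
    Real.Gamma_add_one (s := D / 2 + n) (by positivity)]
  have : D / 2 + n ≠ 0 := by positivity
  generalize Real.Gamma ((D - 1) / 2 + 1) = G at *
  generalize Real.Gamma (D / 2 + n) = G' at *
  field_simp

end IsProfile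

/-! ### The massive one-loop integral -/

/-- Fubini for a superposition of functions with nonnegative `dimDiff`: integrability on the product
follows from that of the values `V`. The representation of `f` is required only for `u ≥ 0` and
almost every `x`, since `dimDiff` evaluates at `u = r²` and `u = 0`. -/
theorem dimDiff_integral_of_nonneg {Ω : Type*} [MeasurableSpace Ω] {μ : Measure Ω} [SFinite μ]
    {D : ℝ} {e : Ω → ℝ → ℝ → ℝ} {f : ℝ → ℝ → ℝ} {V : Ω → ℝ}
    (he : Measurable fun p : Ω × ℝ × ℝ => e p.1 p.2.1 p.2.2)
    (hf : ∀ᵐ x : ℝ, ∀ u, 0 ≤ u → Integrable (fun ω => e ω x u) μ ∧ f x u = ∫ ω, e ω x u ∂μ)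
    (hnn : ∀ᵐ ω ∂μ, ∀ z, 0 ≤ dimDiff D (e ω) z)
    (hV : ∀ᵐ ω ∂μ, ∫⁻ z, ENNReal.ofReal (dimDiff D (e ω) z) ∂dimMeasure D = ENNReal.ofReal (V ω))
    (hV0 : ∀ᵐ ω ∂μ, 0 ≤ V ω) (hVi : Integrable V μ) :
    Integrable (dimDiff D f) (dimMeasure D) ∧
      ∫ z, dimDiff D f z ∂dimMeasure D = ∫ ω, V ω ∂μ := by
  have hm := measurable_dimDiff (D := D) he
  have hint : Integrable (fun p : Ω × ℝ × ℝ => dimDiff D (e p.1) p.2) (μ.prod (dimMeasure D)) := by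
    refine ⟨hm.aestronglyMeasurable, ?_⟩
    rw [hasFiniteIntegral_iff_enorm, lintegral_prod _ hm.enorm.aemeasurable]
    have h1 : ∀ᵐ ω ∂μ, ∫⁻ z, ‖dimDiff D (e ω) z‖ₑ ∂dimMeasure D = ‖V ω‖ₑ := by
      filter_upwards [hnn, hV, hV0] with ω h2 h3 h4
      rw [Real.enorm_of_nonneg h4, ← h3]
      exact lintegral_congr fun z => Real.enorm_of_nonneg (h2 z)
    rw [lintegral_congr_ae h1]
    exact hVi.2
  have hfe : ∀ᵐ z ∂dimMeasure D, dimDiff D f z = ∫ ω, dimDiff D (e ω) z ∂μ := by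
    have h := (Measure.quasiMeasurePreserving_fst (μ := (volume : Measure ℝ))
      (ν := radialMeasure (D - 1))).ae hf
    refine h.mono fun z hz => ?_
    have h1 := hz _ (sq_nonneg z.2)
    have h0 := hz 0 le_rfl
    unfold dimDiff radialDiff
    split_ifs
    · exact h1.2
    · rw [h0.2, h1.2, integral_sub h0.1 h1.1]
  constructor
  · exact hint.integral_prod_right.congr (hfe.mono fun z hz => hz.symm)
  · rw [integral_congr_ae hfe, ← integral_integral_swap hint]
    refine integral_congr_ae ?_
    filter_upwards [hnn, hV, hV0] with ω h2 h3 h4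
    have hmω : Measurable fun z => dimDiff D (e ω) z := hm.comp measurable_prodMk_left
    rw [integral_eq_lintegral_of_nonneg_ae (Filter.Eventually.of_forall h2)
      hmω.aestronglyMeasurable, h3, ENNReal.toReal_ofReal h4]

theorem isProfile_inv_sq {S : ℝ} (hS : 0 < S) :
    IsProfile (fun K => ((K + S) ^ 2)⁻¹) (fun K => 2 * ((K + S) ^ 3)⁻¹) where
  measurable := by fun_prop
  measurable_deriv := by fun_prop
  deriv_nonneg x hx := by positivity
  hasDerivAt x hx := by
    have h : x + S ≠ 0 := by positivity
    have := (((hasDerivAt_id x).add_const S).pow 2).inv (pow_ne_zero 2 h)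
    convert! this using 1
    simp; field_simp
  tendsto := by
    refine Filter.Tendsto.inv_tendsto_atTop ?_
    exact (Filter.tendsto_pow_atTop two_ne_zero).comp
      (Filter.tendsto_atTop_add_const_right _ S Filter.tendsto_id)

/-- The substitution `t = S/(K + S)`, used both for the one-loop integral and for the beta averages.
-/
theorem lintegral_Ioi_eq_lintegral_Ioo {S : ℝ} (hS : 0 < S) (g : ℝ → ENNReal) :
    ∫⁻ K in Ioi 0, g K =
      ∫⁻ t in Ioo (0 : ℝ) 1, ENNReal.ofReal (S / t ^ 2) * g (S * (1 - t) / t) := by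
  have himg : (fun t : ℝ => S * (1 - t) / t) '' Ioo 0 1 = Ioi 0 := by
    ext K
    constructor
    · rintro ⟨t, ⟨h0, h1⟩, rfl⟩
      have : 0 < 1 - t := by linarith
      simp only [mem_Ioi]; positivity
    · intro hK
      have hK' : (0 : ℝ) < K := hK
      refine ⟨S / (K + S), ⟨by positivity, ?_⟩, ?_⟩
      · rw [div_lt_one (by positivity)]; linarith
      · simp only; field_simp; ring
  rw [← himg, lintegral_image_eq_lintegral_abs_deriv_mul measurableSet_Ioo
    (f' := fun t => -(S / t ^ 2))]
  · refine setLIntegral_congr_fun measurableSet_Ioo fun t ht => ?_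
    have := ht.1
    rw [abs_neg, abs_of_pos (by positivity)]
  · intro t ht
    have h0 : t ≠ 0 := ht.1.ne'
    have := (((hasDerivAt_id t).const_sub 1).const_mul S).div (hasDerivAt_id t) h0
    convert! this.hasDerivWithinAt using 1
    simp only [id]; field_simp; ring
  · intro s hs t ht h
    have h0 := hs.1.ne'
    have h1 := ht.1.ne'
    simp only at h
    field_simp at h
    linarith

theorem lintegral_rpow_div_sq {S s : ℝ} (hS : 0 < S) (hs : 0 < s) (hs2 : s < 2) :
    ∫⁻ K in Ioi 0, ENNReal.ofReal (K ^ (s - 1) * ((K + S) ^ 2)⁻¹) =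
      ENNReal.ofReal (S ^ (s - 2) * ProbabilityTheory.beta (2 - s) s) := by
  rw [lintegral_Ioi_eq_lintegral_Ioo hS, ENNReal.ofReal_mul (by positivity),
    ← lintegral_beta (by linarith) hs, ← lintegral_const_mul' _ _ ENNReal.ofReal_ne_top]
  refine setLIntegral_congr_fun measurableSet_Ioo fun t ht => ?_
  obtain ⟨h0, h1⟩ := ht
  have h1' : 0 < 1 - t := by linarith
  rw [← ENNReal.ofReal_mul (by positivity), ← ENNReal.ofReal_mul (by positivity)]
  congr 1
  have e : S * (1 - t) / t + S = S / t := by field_simp; ring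
  rw [e, Real.div_rpow (by positivity) h0.le, Real.mul_rpow hS.le h1'.le,
    show s - 1 = s - 2 + 1 by ring, Real.rpow_add_one hS.ne', show 2 - s - 1 = -(s - 2 + 1) by ring,
    Real.rpow_neg h0.le]
  have : t ^ (s - 2 + 1) ≠ 0 := (Real.rpow_pos_of_pos h0 _).ne'
  field_simp

theorem lintegral_dimDiff_inv_sq {D S : ℝ} (hD : 0 < D) (hD4 : D < 4) (hS : 0 < S) (c : ℝ) :
    ∫⁻ z, ENNReal.ofReal (dimDiff D (fun x u => (((x + c) ^ 2 + u + S) ^ 2)⁻¹) z) ∂dimMeasure D =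
      ENNReal.ofReal (Real.pi ^ (D / 2) * Real.Gamma (2 - D / 2) * S ^ (D / 2 - 2)) := by
  have h := (isProfile_inv_sq hS).lintegral_dimDiff hD 0 c
  simp only [mul_zero, pow_zero, one_mul, Nat.cast_zero, add_zero, zero_add] at h
  rw [h, lintegral_rpow_div_sq hS (by positivity) (by linarith), ← ENNReal.ofReal_mul']
  · congr 1
    have hG : Real.Gamma (D / 2) ≠ 0 := (Real.Gamma_pos_of_pos (by positivity)).ne'
    rw [ProbabilityTheory.beta, sub_add_cancel, Real.Gamma_two, Real.Gamma_one_half_eq,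
      show D / 2 = (D - 1) / 2 + 1 / 2 by ring, Real.rpow_add Real.pi_pos, ← Real.sqrt_eq_rpow,
      show (D - 1) / 2 + 1 / 2 = D / 2 by ring]
    field_simp
  · have := ProbabilityTheory.beta_pos (α := 2 - D / 2) (β := D / 2) (by linarith) (by positivity)
    positivity

theorem integral_feynman_parameter {A B : ℝ} (hA : 0 < A) (hB : 0 < B) :
    IntegrableOn (fun α : ℝ => (((1 - α) * A + α * B) ^ 2)⁻¹) (Ioc 0 1) ∧
      ∫ α in Ioc (0 : ℝ) 1, (((1 - α) * A + α * B) ^ 2)⁻¹ = 1 / A * (1 / B) := by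
  have hpos : ∀ α ∈ uIcc (0 : ℝ) 1, 0 < (1 - α) * A + α * B := by
    intro α hα
    rw [uIcc_of_le zero_le_one] at hα
    rcases hα.1.eq_or_lt with h | h
    · rw [← h]; simpa using hA
    · have : 0 ≤ (1 - α) * A := mul_nonneg (by linarith [hα.2]) hA.le
      positivity
  have hc : ContinuousOn (fun α : ℝ => (((1 - α) * A + α * B) ^ 2)⁻¹) (uIcc 0 1) :=
    ContinuousOn.inv₀ (by fun_prop) fun α hα => pow_ne_zero 2 (hpos α hα).ne'
  have hi := hc.intervalIntegrable (μ := volume)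
  refine ⟨hi.1, ?_⟩
  -- The primitive is normalized to vanish at `α = 0`, which avoids dividing by `B - A`.
  rw [← intervalIntegral.integral_of_le zero_le_one,
    intervalIntegral.integral_eq_sub_of_hasDerivAt
      (f := fun α => α / (A * ((1 - α) * A + α * B))) (fun α hα => ?_) hi]
  · simp; field_simp
  · have h := hpos α hα
    have hd : HasDerivAt (fun α : ℝ => A * ((1 - α) * A + α * B)) (A * (-1 * A + 1 * B)) α :=
      ((((hasDerivAt_id α).const_sub 1).mul_const A).add ((hasDerivAt_id α).mul_const B)).const_mul A
    have := (hasDerivAt_id α).div hd (mul_pos hA h).ne'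
    convert! this using 1
    simp only [id]; field_simp; ring

/-- The combination of the two squared masses and the squared momentum in the Feynman
parametrization of the one-loop integral. -/
def feynmanMass (m₁ m₂ p α : ℝ) : ℝ := (1 - α) * m₁ ^ 2 + α * m₂ ^ 2 + α * (1 - α) * p ^ 2

theorem feynmanMass_pos {m₁ m₂ p α : ℝ} (h1 : 0 < m₁) (h2 : 0 < m₂) (h : α ∈ Icc (0 : ℝ) 1) :
    0 < feynmanMass m₁ m₂ p α := by
  obtain ⟨ha, hb⟩ := h
  have hb' : 0 ≤ 1 - α := by linarith
  unfold feynmanMass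
  rcases ha.eq_or_lt with h | h
  · rw [← h]; simp; positivity
  · positivity

theorem integral_dimDiff_one_loop_feynman {D m₁ m₂ p : ℝ} (hD : 0 < D) (hD4 : D < 4)
    (h1 : 0 < m₁) (h2 : 0 < m₂) :
    let f : ℝ → ℝ → ℝ := fun x u => 1 / (x ^ 2 + u + m₁ ^ 2) * (1 / ((x + p) ^ 2 + u + m₂ ^ 2))
    Integrable (dimDiff D f) (dimMeasure D) ∧ ∫ z, dimDiff D f z ∂dimMeasure D =
      Real.pi ^ (D / 2) * Real.Gamma (2 - D / 2) *
        ∫ α in (0 : ℝ)..1, feynmanMass m₁ m₂ p α ^ (D / 2 - 2) := by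
  intro f
  have hcont : Continuous (feynmanMass m₁ m₂ p) := by unfold feynmanMass; fun_prop
  have hG : 0 < Real.Gamma (2 - D / 2) := Real.Gamma_pos_of_pos (by linarith)
  have hci : IntervalIntegrable (fun α => Real.pi ^ (D / 2) * Real.Gamma (2 - D / 2) *
      feynmanMass m₁ m₂ p α ^ (D / 2 - 2)) volume 0 1 := by
    refine ContinuousOn.intervalIntegrable ?_
    rw [uIcc_of_le zero_le_one]
    exact continuousOn_const.mul (hcont.continuousOn.rpow_const fun α hα =>
      Or.inl (feynmanMass_pos h1 h2 hα).ne')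
  have hmem : ∀ᵐ α ∂volume.restrict (Ioc (0 : ℝ) 1), α ∈ Icc (0 : ℝ) 1 := by
    filter_upwards [ae_restrict_mem measurableSet_Ioc] with α hα using Ioc_subset_Icc_self hα
  rw [← intervalIntegral.integral_const_mul, intervalIntegral.integral_of_le zero_le_one]
  refine dimDiff_integral_of_nonneg (Ω := ℝ) (μ := volume.restrict (Ioc 0 1))
    (e := fun α x u => (((x + α * p) ^ 2 + u + feynmanMass m₁ m₂ p α) ^ 2)⁻¹)
    (by have := hcont.measurable; fun_prop) ?_ ?_ ?_ ?_ hci.1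
  · refine Filter.Eventually.of_forall fun x u hu => ?_
    have h := integral_feynman_parameter (A := x ^ 2 + u + m₁ ^ 2) (B := (x + p) ^ 2 + u + m₂ ^ 2)
      (by positivity) (by positivity)
    -- Completing the square: for each `α` the denominator is radial about `x = -αp`.
    have e : ∀ α : ℝ, (1 - α) * (x ^ 2 + u + m₁ ^ 2) + α * ((x + p) ^ 2 + u + m₂ ^ 2) =
        (x + α * p) ^ 2 + u + feynmanMass m₁ m₂ p α := by
      intro α; unfold feynmanMass; ring
    simp only [e] at h
    exact ⟨h.1, h.2.symm⟩
  · filter_upwards [hmem] with α hα z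
    have hS := feynmanMass_pos (p := p) h1 h2 hα
    exact (isProfile_inv_sq hS).radialDiff_nonneg (D - 1) (z.1 + α * p) z.2
  · filter_upwards [hmem] with α hα
    exact lintegral_dimDiff_inv_sq hD hD4 (feynmanMass_pos h1 h2 hα) _
  · filter_upwards [hmem] with α hα
    have := feynmanMass_pos (p := p) h1 h2 hα
    positivity

/-- The quantity `√(σ² + (1 - v²) p²)`. -/
def loopRoot (σ p v : ℝ) : ℝ := Real.sqrt (σ ^ 2 + (1 - v ^ 2) * p ^ 2)

theorem le_loopRoot {σ p v : ℝ} (hv : v ∈ Icc (-1 : ℝ) 1) : σ ≤ loopRoot σ p v := by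
  refine Real.le_sqrt_of_sq_le ?_
  have : 0 ≤ 1 - v ^ 2 := by nlinarith [hv.1, hv.2]
  nlinarith [mul_nonneg this (sq_nonneg p)]

theorem loopRoot_sq {σ p v : ℝ} (hv : v ∈ Icc (-1 : ℝ) 1) :
    loopRoot σ p v ^ 2 = σ ^ 2 + (1 - v ^ 2) * p ^ 2 := by
  refine Real.sq_sqrt ?_
  have : 0 ≤ 1 - v ^ 2 := by nlinarith [hv.1, hv.2]
  positivity

theorem abs_mul_lt_loopRoot {σ δ p v : ℝ} (hδ : |δ| < σ) (hv : v ∈ Icc (-1 : ℝ) 1) :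
    |v * δ| < loopRoot σ p v := by
  refine lt_of_le_of_lt ?_ (hδ.trans_le (le_loopRoot hv))
  rw [abs_mul]
  exact mul_le_of_le_one_left (abs_nonneg _) (abs_le.2 ⟨hv.1, hv.2⟩)

/-- The substitution `α = a(v)` rationalizes the quadratic form: it becomes `((R + vδ)/2)²`, while
`dα = (R + vδ)/(2R) dv` supplies one more power of the same factor. -/
theorem integral_feynmanMass_rpow {m₁ m₂ p : ℝ} (h1 : 0 < m₁) (h2 : 0 < m₂) (hp : 0 < p) (γ : ℝ) :
    ∫ α in (0 : ℝ)..1, feynmanMass m₁ m₂ p α ^ γ =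
      ∫ v in (-1 : ℝ)..1, ((loopRoot (m₁ + m₂) p v + v * (m₂ - m₁)) / 2) ^ (2 * γ + 1) /
        loopRoot (m₁ + m₂) p v := by
  set σ := m₁ + m₂ with hσ
  set δ := m₂ - m₁ with hδ
  have hδσ : |δ| < σ := by rw [abs_lt]; constructor <;> linarith
  have hσ0 : 0 < σ := by positivity
  -- The primitive of `(R + vδ)/(2R)` that vanishes at `v = -1`, from `R' = -v p²/R`; as `R = σ` at
  -- both ends, it equals 1 at `v = 1`.
  let a : ℝ → ℝ := fun v => (1 + v - δ * (loopRoot σ p v - σ) / p ^ 2) / 2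
  let a' : ℝ → ℝ := fun v => (loopRoot σ p v + v * δ) / (2 * loopRoot σ p v)
  have hIcc : uIcc (-1 : ℝ) 1 = Icc (-1) 1 := uIcc_of_le (by norm_num)
  have hR0 : ∀ v ∈ uIcc (-1 : ℝ) 1, 0 < loopRoot σ p v := fun v hv =>
    hσ0.trans_le (le_loopRoot (hIcc ▸ hv))
  have hRc : Continuous (loopRoot σ p) := by unfold loopRoot; fun_prop
  have hend : ∀ v : ℝ, v ^ 2 = 1 → loopRoot σ p v = σ := by
    intro v hv
    rw [loopRoot, hv]; simp [Real.sqrt_sq hσ0.le]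
  have hpos : ∀ v ∈ uIcc (-1 : ℝ) 1, 0 < loopRoot σ p v + v * δ := fun v hv => by
    have := abs_lt.1 (abs_mul_lt_loopRoot (p := p) hδσ (hIcc ▸ hv))
    linarith [this.1]
  have hS : ∀ v ∈ uIcc (-1 : ℝ) 1, feynmanMass m₁ m₂ p (a v) =
      ((loopRoot σ p v + v * δ) / 2) ^ 2 := by
    intro v hv
    have hR := loopRoot_sq (σ := σ) (p := p) (hIcc ▸ hv)
    have hm1 : m₁ = (σ - δ) / 2 := by rw [hσ, hδ]; ring
    have hm2 : m₂ = (σ + δ) / 2 := by rw [hσ, hδ]; ring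
    simp only [a, feynmanMass]
    clear_value σ δ
    subst hm1 hm2
    generalize loopRoot σ p v = R at *
    field_simp
    linear_combination (-2 * (p ^ 2 + δ ^ 2)) * hR
  have hcv := intervalIntegral.integral_comp_mul_deriv' (a := -1) (b := 1) (f := a) (f' := a')
    (g := fun α => feynmanMass m₁ m₂ p α ^ γ) ?_ ?_ ?_
  · have ha1 : a 1 = 1 := by simp [a, hend]
    have ha0 : a (-1) = 0 := by simp [a, hend]
    rw [ha1, ha0] at hcv
    rw [← hcv]
    refine intervalIntegral.integral_congr fun v hv => ?_
    have hp1 := hpos v hv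
    have hp2 := hR0 v hv
    simp only [Function.comp, hS v hv, a']
    rw [← Real.rpow_natCast, ← Real.rpow_mul (by positivity), Nat.cast_ofNat,
      Real.rpow_add_one (by positivity)]
    field_simp
  · intro v hv
    have hR := hR0 v hv
    have hne : σ ^ 2 + (1 - v ^ 2) * p ^ 2 ≠ 0 := by
      rw [← loopRoot_sq (hIcc ▸ hv)]; positivity
    have hd : HasDerivAt (loopRoot σ p) (-(2 * v) * p ^ 2 / (2 * loopRoot σ p v)) v := by
      have h := ((((hasDerivAt_id v).pow 2).const_sub 1).mul_const (p ^ 2)).const_add (σ ^ 2)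
      have h' := h.sqrt (by simpa using hne)
      convert! h' using 1
      simp [loopRoot]
    have := ((((hasDerivAt_id v).const_add 1).sub
      (((hd.sub_const σ).const_mul δ).div_const (p ^ 2))).div_const 2)
    convert! this using 1
    simp only [a']
    field_simp; ring
  · exact ContinuousOn.div (by fun_prop) (by fun_prop) fun v hv => by
      have := hR0 v hv; positivity
  · rintro _ ⟨v, hv, rfl⟩
    refine ContinuousAt.continuousWithinAt (ContinuousAt.rpow_const ?_ (Or.inl ?_))
    · unfold feynmanMass; fun_prop
    · rw [hS v hv]
      have := hpos v hv
      positivity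

/-- The one-loop integral with masses `m₁` and `m₂` in dimension `D`. -/
theorem integral_dimDiff_one_loop {D m₁ m₂ p : ℝ} (hD : 0 < D) (hD4 : D < 4)
    (h1 : 0 < m₁) (h2 : 0 < m₂) (hp : 0 < p) :
    let f : ℝ → ℝ → ℝ := fun x u => 1 / (x ^ 2 + u + m₁ ^ 2) * (1 / ((x + p) ^ 2 + u + m₂ ^ 2))
    Integrable (dimDiff D f) (dimMeasure D) ∧ ∫ z, dimDiff D f z ∂dimMeasure D =
      Real.pi ^ (D / 2) * Real.Gamma (2 - D / 2) *
        ∫ v in (-1 : ℝ)..1, ((loopRoot (m₁ + m₂) p v + v * (m₂ - m₁)) / 2) ^ (D - 3) /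
          loopRoot (m₁ + m₂) p v := by
  intro f
  have h := integral_dimDiff_one_loop_feynman (p := p) hD hD4 h1 h2
  rw [integral_feynmanMass_rpow h1 h2 hp, show 2 * (D / 2 - 2) + 1 = D - 3 by ring] at h
  exact h

/-! ### The terms of the expansion -/

theorem isProfile_rpow {A B c : ℝ} (hA : 0 < A) (hB : 0 ≤ B) (hc : 0 < c) :
    IsProfile (fun K => ((2 * K + A) ^ 2 + B) ^ (-c))
      (fun K => 4 * c * (2 * K + A) * ((2 * K + A) ^ 2 + B) ^ (-c - 1)) where
  measurable := by fun_prop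
  measurable_deriv := by fun_prop
  deriv_nonneg x hx := by positivity
  hasDerivAt x hx := by
    have h0 : (2 * x + A) ^ 2 + B ≠ 0 := by positivity
    have h1 : HasDerivAt (fun K : ℝ => (2 * K + A) ^ 2 + B) (4 * (2 * x + A)) x := by
      have := ((((hasDerivAt_id x).const_mul 2).add_const A).pow 2).add_const B
      convert! this using 1
      simp; ring
    have := h1.rpow_const (p := -c) (Or.inl h0)
    convert! this using 1
    ring
  tendsto := by
    refine (tendsto_rpow_neg_atTop hc).comp ?_
    refine Filter.tendsto_atTop_add_const_right _ B ?_
    refine (Filter.tendsto_pow_atTop two_ne_zero).comp ?_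
    exact Filter.tendsto_atTop_add_const_right _ A
      (Filter.tendsto_id.const_mul_atTop (by norm_num))

/-- The weight of the beta distribution, without normalization. -/
def betaWeight (α β t : ℝ) : ℝ := t ^ (α - 1) * (1 - t) ^ (β - 1)

theorem betaWeight_nonneg (α β : ℝ) {t : ℝ} (ht : t ∈ Ioo (0 : ℝ) 1) : 0 ≤ betaWeight α β t := by
  have := ht.1
  have : 0 < 1 - t := by linarith [ht.2]
  unfold betaWeight; positivity

theorem measurable_betaWeight (α β : ℝ) : Measurable (betaWeight α β) := by
  unfold betaWeight; fun_prop

theorem integral_betaWeight {α β : ℝ} (hα : 0 < α) (hβ : 0 < β) :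
    IntegrableOn (betaWeight α β) (Ioo 0 1) ∧
      ∫ t in Ioo (0 : ℝ) 1, betaWeight α β t = ProbabilityTheory.beta α β := by
  have h := lintegral_beta hα hβ
  have hn : 0 ≤ᵐ[volume.restrict (Ioo (0 : ℝ) 1)] betaWeight α β := by
    filter_upwards [ae_restrict_mem measurableSet_Ioo] with t ht using betaWeight_nonneg α β ht
  have hm := (measurable_betaWeight α β).aestronglyMeasurable
    (μ := volume.restrict (Ioo (0 : ℝ) 1))
  constructor
  · refine ⟨hm, ?_⟩
    rw [hasFiniteIntegral_iff_ofReal hn]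
    simp only [betaWeight]
    rw [h]; exact ENNReal.ofReal_lt_top
  · rw [integral_eq_lintegral_of_nonneg_ae hn hm]
    simp only [betaWeight]
    rw [h, ENNReal.toReal_ofReal (ProbabilityTheory.beta_pos hα hβ).le]

/-- The average of `(1 + Y t²) ^ (-c)` with respect to the weight of a beta distribution. -/
def betaAverage (α β c Y : ℝ) : ℝ :=
  ∫ t in Ioo (0 : ℝ) 1, betaWeight α β t * (1 + t ^ 2 * Y) ^ (-c)

theorem integrable_betaAverage {α β c Y : ℝ} (hα : 0 < α) (hβ : 0 < β) (hc : 0 < c) (hY : 0 ≤ Y) :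
    IntegrableOn (fun t => betaWeight α β t * (1 + t ^ 2 * Y) ^ (-c)) (Ioo 0 1) := by
  refine Integrable.mono (integral_betaWeight hα hβ).1
    (((measurable_betaWeight α β).mul (g := fun t => (1 + t ^ 2 * Y) ^ (-c))
      (by fun_prop)).aestronglyMeasurable) ?_
  refine Filter.Eventually.of_forall fun t => ?_
  rw [norm_mul]
  refine mul_le_of_le_one_right (norm_nonneg _) ?_
  have : 0 ≤ t ^ 2 * Y := by positivity
  rw [Real.norm_of_nonneg (by positivity)]
  exact Real.rpow_le_one_of_one_le_of_nonpos (by linarith) (by linarith)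

theorem betaAverage_nonneg {α β c Y : ℝ} (hY : 0 ≤ Y) : 0 ≤ betaAverage α β c Y :=
  setIntegral_nonneg measurableSet_Ioo fun t ht =>
    mul_nonneg (betaWeight_nonneg α β ht) (by positivity)

/-- With `K = (A/2)(1 - t)/t` one has `2K + A = A/t`, so the profile factors as a power of `A/t`
times `(1 + t²X)^(-c)`. -/
theorem lintegral_rpow_mul_profile {A X Y c s : ℝ} (hA : 0 < A) (hX : 0 ≤ X) (hY : Y = X * A ^ 2)
    (hs : 0 < s) (hc : s < 2 * c) :
    ∫⁻ K in Ioi 0, ENNReal.ofReal (K ^ (s - 1) * ((2 * K + A) ^ 2 + Y) ^ (-c)) =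
      ENNReal.ofReal ((A / 2) ^ s * A ^ (-(2 * c)) * betaAverage (2 * c - s) s c X) := by
  have hc0 : 0 < c := by linarith
  rw [lintegral_Ioi_eq_lintegral_Ioo (half_pos hA), ENNReal.ofReal_mul (by positivity), betaAverage,
    ofReal_integral_eq_lintegral_ofReal (integrable_betaAverage (by linarith) hs hc0 hX),
    ← lintegral_const_mul' _ _ ENNReal.ofReal_ne_top]
  · refine setLIntegral_congr_fun measurableSet_Ioo fun t ht => ?_
    have h0 := ht.1
    have h1' : 0 < 1 - t := by linarith [ht.2]
    rw [← ENNReal.ofReal_mul (by positivity), ← ENNReal.ofReal_mul (by positivity)]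
    congr 1
    have e : (2 * (A / 2 * (1 - t) / t) + A) ^ 2 + Y = (A / t) ^ 2 * (1 + t ^ 2 * X) := by
      rw [hY]; field_simp; ring
    have e2 : ((A / t) ^ 2) ^ (-c) = A ^ (-(2 * c)) * t ^ (2 * c) := by
      rw [← Real.rpow_natCast, ← Real.rpow_mul (by positivity), Real.div_rpow hA.le h0.le,
        Nat.cast_ofNat, show (2 : ℝ) * -c = -(2 * c) by ring, Real.rpow_neg h0.le, div_inv_eq_mul]
    have e3 : t ^ (2 * c - s - 1) = t ^ (2 * c) / t ^ (s - 1) / t ^ 2 := by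
      rw [← Real.rpow_sub h0, ← Real.rpow_two, ← Real.rpow_sub h0]; ring_nf
    rw [e, Real.mul_rpow (by positivity) (by positivity), e2, Real.div_rpow (by positivity) h0.le,
      Real.mul_rpow (by positivity) h1'.le, betaWeight, e3,
      show (A / 2) ^ s = (A / 2) ^ (s - 1) * (A / 2) by
        rw [← Real.rpow_add_one (by positivity), sub_add_cancel]]
    have : t ^ (s - 1) ≠ 0 := (Real.rpow_pos_of_pos h0 _).ne'
    field_simp
  · filter_upwards [ae_restrict_mem measurableSet_Ioo] with t ht
    exact mul_nonneg (betaWeight_nonneg _ _ ht) (by positivity)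

theorem integral_pow_mul_one_sub_sq (n j : ℕ) :
    ∫ v in Ioo (-1 : ℝ) 1, v ^ (2 * n) * (1 - v ^ 2) ^ j =
      ProbabilityTheory.beta (n + 1 / 2) (j + 1) := by
  have h := lintegral_pow_mul_ball n (ν := 2 * j) (M := 1) (by
    have : (0 : ℝ) ≤ j := Nat.cast_nonneg j
    linarith) one_pos
  rw [Real.one_rpow, mul_one, show (2 * (j : ℝ)) / 2 = j by ring] at h
  have e : ∀ x : ℝ, ENNReal.ofReal (x ^ (2 * n) *
      if 0 < 1 - x ^ 2 then (1 - x ^ 2) ^ (j : ℝ) else 0) =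
      (Ioo (-1 : ℝ) 1).indicator (fun v => ENNReal.ofReal (v ^ (2 * n) * (1 - v ^ 2) ^ j)) x := by
    intro x
    have : 0 < 1 - x ^ 2 ↔ x ∈ Ioo (-1 : ℝ) 1 := by
      rw [sub_pos, sq_lt_one_iff_abs_lt_one, abs_lt, mem_Ioo]
    simp only [this, indicator, Real.rpow_natCast]
    split_ifs <;> simp
  simp_rw [e] at h
  rw [lintegral_indicator measurableSet_Ioo] at h
  rw [integral_eq_lintegral_of_nonneg_ae, h, ENNReal.toReal_ofReal
    (ProbabilityTheory.beta_pos (by positivity) (by positivity)).le]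
  · filter_upwards [ae_restrict_mem measurableSet_Ioo] with v hv
    have h1 : 0 ≤ v ^ (2 * n) := by rw [pow_mul]; positivity
    have : 0 ≤ 1 - v ^ 2 := by nlinarith [hv.1, hv.2]
    simp only [Pi.zero_apply]
    positivity
  · fun_prop

/-- The moments of the product of the two weights as Pochhammer symbols. -/
theorem bincoef_mul_beta_mul_beta {a μ c : ℝ} (ha : 0 < a) (hμ : 0 < μ) (hc : 2 * c = a + μ)
    (n j : ℕ) :
    bincoef c j * (ProbabilityTheory.beta (n + 1 / 2) (j + 1) *
        ProbabilityTheory.beta (a + (2 * j : ℕ)) μ) =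
      ProbabilityTheory.beta a μ / (n + 1 / 2) *
        (poch (a / 2) j / poch (3 / 2 + n) j * (poch ((a + 1) / 2) j / poch (c + 1 / 2) j)) := by
  have hn : (0 : ℝ) ≤ n := Nat.cast_nonneg n
  have hc0 : 0 < c := by linarith
  have h1 : ProbabilityTheory.beta ((n : ℝ) + 1 / 2) (j + 1) =
      (j.factorial : ℝ) / ((n + 1 / 2) * poch (3 / 2 + n) j) := by
    rw [ProbabilityTheory.beta, Real.Gamma_nat_eq_factorial,
      show (n : ℝ) + 1 / 2 + (j + 1) = 3 / 2 + n + j by ring, Gamma_add_nat (by positivity),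
      show (3 : ℝ) / 2 + n = n + 1 / 2 + 1 by ring, Real.Gamma_add_one (by positivity)]
    have := (Real.Gamma_pos_of_pos (s := (n : ℝ) + 1 / 2) (by positivity)).ne'
    have := (poch_pos (x := (n : ℝ) + 1 / 2 + 1) (by positivity) j).ne'
    field_simp
  -- Because `a + μ = 2c`, duplication gives `(2c)_{2j} = 4^j (c)_j (c + 1/2)_j`. The factor `(c)_j`
  -- cancels the numerator of `bincoef c j`, as `j!` from the other beta function cancels its
  -- denominator.
  have h2 : ProbabilityTheory.beta (a + (2 * j : ℕ)) μ = ProbabilityTheory.beta a μ *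
      (poch (a / 2) j * poch ((a + 1) / 2) j / (poch c j * poch (c + 1 / 2) j)) := by
    rw [ProbabilityTheory.beta, ProbabilityTheory.beta, add_right_comm, Gamma_add_nat ha,
      Gamma_add_nat (by positivity), poch_two_mul, poch_two_mul,
      show (a + μ) / 2 = c by linarith, show (a + μ + 1) / 2 = c + 1 / 2 by linarith]
    have := (Real.Gamma_pos_of_pos (s := a + μ) (by positivity)).ne'
    have := (poch_pos hc0 j).ne'
    have := (poch_pos (x := c + 1 / 2) (by positivity) j).ne'
    field_simp
  rw [h1, h2, bincoef]
  have := (poch_pos hc0 j).ne'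
  have := (poch_pos (x := c + 1 / 2) (by positivity) j).ne'
  have := (poch_pos (x := 3 / 2 + (n : ℝ)) (by positivity) j).ne'
  field_simp

/-- The weight on the square `(-1, 1) × (0, 1)`. -/
theorem integrable_pow_mul_betaWeight {α β : ℝ} (hα : 0 < α) (hβ : 0 < β) (n : ℕ) :
    Integrable (fun z : ℝ × ℝ => z.1 ^ (2 * n) * betaWeight α β z.2)
      ((volume.restrict (Ioo (-1 : ℝ) 1)).prod (volume.restrict (Ioo (0 : ℝ) 1))) := by
  refine Integrable.mul_prod (f := fun v : ℝ => v ^ (2 * n)) ?_ (integral_betaWeight hα hβ).1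
  exact (((continuous_pow (2 * n)).continuousOn (s := Icc (-1 : ℝ) 1)).integrableOn_Icc).mono_set
    Ioo_subset_Icc_self

/-- The generating function of `jacobiPoly` at `τ = t²(1 - v²) ∈ [0, 1]` is integrated over the
square in `(v, t)`. `jacobiBound` is a majorant independent of the point, so summation and
integration commute. -/
theorem hasSum_betaAverage {a μ c z X : ℝ} (ha : 0 < a) (hμ : 0 < μ) (hc : 2 * c = a + μ)
    (h0 : 0 ≤ z) (h1 : z < 1) (hX : X = z / (1 - z)) (n : ℕ) :
    IntegrableOn (fun v : ℝ => v ^ (2 * n) * betaAverage a μ c (X * (1 - v ^ 2))) (Ioo (-1) 1) ∧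
    HasSum (fun k : ℕ => ProbabilityTheory.beta a μ / (n + 1 / 2) * ((∑ j ∈ Finset.range (k + 1),
      (-1) ^ j * (k.choose j : ℝ) * (poch (a / 2) j / poch (3 / 2 + n) j *
        (poch ((a + 1) / 2) j / poch (c + 1 / 2) j))) * z ^ k))
      ((1 - z)⁻¹ * ∫ v in Ioo (-1 : ℝ) 1,
        v ^ (2 * n) * betaAverage a μ c (X * (1 - v ^ 2))) := by
  have hc0 : 0 < c := by linarith
  have hX0 : 0 ≤ X := by rw [hX]; exact div_nonneg h0 (by linarith)
  set M := (volume.restrict (Ioo (-1 : ℝ) 1)).prod (volume.restrict (Ioo (0 : ℝ) 1)) with hM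
  have hmem : ∀ᵐ y ∂M, y ∈ Ioo (-1 : ℝ) 1 ×ˢ Ioo (0 : ℝ) 1 := by
    rw [hM, Measure.prod_restrict]
    exact ae_restrict_mem (measurableSet_Ioo.prod measurableSet_Ioo)
  let w : ℝ × ℝ → ℝ := fun y => y.1 ^ (2 * n) * betaWeight a μ y.2
  let τ : ℝ × ℝ → ℝ := fun y => y.2 ^ 2 * (1 - y.1 ^ 2)
  have hw : Integrable w M := integrable_pow_mul_betaWeight ha hμ n
  have hτm : Measurable τ := by fun_prop
  have hτ : ∀ y ∈ Ioo (-1 : ℝ) 1 ×ˢ Ioo (0 : ℝ) 1, 0 ≤ τ y ∧ τ y ≤ 1 := by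
    rintro y ⟨⟨ha, hb⟩, ⟨hc, hd⟩⟩
    have e1 : 0 ≤ 1 - y.1 ^ 2 := by nlinarith
    have e2 : y.2 ^ 2 ≤ 1 := by nlinarith
    constructor
    · positivity
    · exact mul_le_one₀ e2 e1 (by nlinarith)
  have hPm : ∀ k, Measurable fun y => jacobiPoly c k (τ y) := by
    intro k; unfold jacobiPoly; fun_prop
  have hbound : ∀ k, ∀ᵐ y ∂M, ‖jacobiPoly c k (τ y)‖ ≤ jacobiBound c k := fun k => by
    filter_upwards [hmem] with y hy
    exact abs_jacobiPoly_le c k (hτ y hy).1 (hτ y hy).2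
  have hFi : ∀ k, Integrable (fun y => w y * (jacobiPoly c k (τ y) * z ^ k)) M := by
    intro k
    refine hw.mul_bdd (c := jacobiBound c k * z ^ k)
      ((hPm k).mul_const _).aestronglyMeasurable ?_
    filter_upwards [hbound k] with y hy
    rw [norm_mul, Real.norm_of_nonneg (pow_nonneg h0 k)]
    exact mul_le_mul_of_nonneg_right hy (pow_nonneg h0 k)
  have hsum : Summable fun k => ∫ y, ‖w y * (jacobiPoly c k (τ y) * z ^ k)‖ ∂M := by
    refine Summable.of_nonneg_of_le (fun k => integral_nonneg fun _ => norm_nonneg _) (fun k => ?_)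
      ((summable_jacobiBound c h0 h1).mul_left (∫ y, ‖w y‖ ∂M))
    rw [← integral_mul_const]
    refine integral_mono_ae (hFi k).norm (hw.norm.mul_const _) ?_
    filter_upwards [hbound k] with y hy
    rw [norm_mul (w y), norm_mul (jacobiPoly c k (τ y)), Real.norm_of_nonneg (pow_nonneg h0 k)]
    exact mul_le_mul_of_nonneg_left (mul_le_mul_of_nonneg_right hy (pow_nonneg h0 k))
      (norm_nonneg _)
  have hS := hasSum_integral_of_summable_integral_norm hFi hsum
  have hΦ : ∀ᵐ y ∂M, ∑' k, w y * (jacobiPoly c k (τ y) * z ^ k) =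
      (1 - z)⁻¹ * (w y * (1 + X * τ y) ^ (-c)) := by
    filter_upwards [hmem] with y hy
    rw [tsum_mul_left, (hasSum_jacobiPoly c h0 h1 (hτ y hy).1 (hτ y hy).2).tsum_eq, hX]; ring
  have hΦi : Integrable (fun y => w y * (1 + X * τ y) ^ (-c)) M := by
    refine hw.mul_bdd (c := 1) (by fun_prop : Measurable _).aestronglyMeasurable ?_
    filter_upwards [hmem] with y hy
    have := mul_nonneg hX0 (hτ y hy).1
    rw [Real.norm_of_nonneg (by positivity)]
    exact Real.rpow_le_one_of_one_le_of_nonpos (by linarith) (by linarith)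
  have einner : ∀ v : ℝ, ∫ t in Ioo (0 : ℝ) 1, w (v, t) * (1 + X * τ (v, t)) ^ (-c) =
      v ^ (2 * n) * betaAverage a μ c (X * (1 - v ^ 2)) := by
    intro v
    rw [betaAverage, ← integral_const_mul]
    refine integral_congr_ae (Filter.Eventually.of_forall fun t => ?_)
    simp only [w, τ]
    rw [mul_assoc, show X * (t ^ 2 * (1 - v ^ 2)) = t ^ 2 * (X * (1 - v ^ 2)) by ring]
  constructor
  · have := hΦi.integral_prod_left
    simp only [einner] at this
    exact this
  · rw [integral_congr_ae hΦ, integral_const_mul, integral_prod _ hΦi] at hS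
    simp only [einner] at hS
    refine hasSum_of_forall_eq hS fun k => ?_
    -- The powers of `τ` factor into a function of `v` times a function of `t`, so each moment is a
    -- product of two beta functions.
    have hmom : ∀ j : ℕ, Integrable (fun y => w y * τ y ^ j) M ∧ ∫ y, w y * τ y ^ j ∂M =
        ProbabilityTheory.beta (n + 1 / 2) (j + 1) *
          ProbabilityTheory.beta (a + (2 * j : ℕ)) μ := by
      intro j
      constructor
      · refine hw.mul_bdd (c := 1) (hτm.pow_const j).aestronglyMeasurable ?_
        filter_upwards [hmem] with y hy
        rw [norm_pow, Real.norm_of_nonneg (hτ y hy).1]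
        exact pow_le_one₀ (hτ y hy).1 (hτ y hy).2
      · have e : ∀ᵐ y ∂M, w y * τ y ^ j =
            (y.1 ^ (2 * n) * (1 - y.1 ^ 2) ^ j) * betaWeight (a + (2 * j : ℕ)) μ y.2 := by
          filter_upwards [hmem] with y hy
          have ht : 0 < y.2 := hy.2.1
          simp only [w, τ, betaWeight]
          rw [add_sub_right_comm, Real.rpow_add_natCast ht.ne', mul_pow, ← pow_mul]
          ring
        rw [integral_congr_ae e, integral_prod_mul (fun v : ℝ => v ^ (2 * n) * (1 - v ^ 2) ^ j)
          (betaWeight (a + (2 * j : ℕ)) μ), integral_pow_mul_one_sub_sq,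
          (integral_betaWeight (by positivity) hμ).2]
    have e2 : ∀ y, w y * (jacobiPoly c k (τ y) * z ^ k) = ∑ j ∈ Finset.range (k + 1),
        ((k.choose j : ℝ) * bincoef c j * (-1) ^ j * z ^ k) * (w y * τ y ^ j) := by
      intro y
      rw [jacobiPoly, Finset.sum_mul, Finset.mul_sum]
      refine Finset.sum_congr rfl fun j _ => ?_
      rw [neg_pow]; ring
    simp only [e2]
    rw [integral_finsetSum _ fun j _ => (hmom j).1.const_mul _, Finset.sum_mul, Finset.mul_sum]
    refine Finset.sum_congr rfl fun j _ => ?_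
    rw [integral_const_mul, (hmom j).2]
    have := bincoef_mul_beta_mul_beta ha hμ hc n j
    linear_combination (-((k.choose j : ℝ) * (-1) ^ j * z ^ k)) * this

/-! ### The double series -/

/-- Integrability of the sum is a conclusion here: it is needed to rewrite `dimIntegral` as an
integral against `dimMeasure`. -/
theorem integrable_of_hasSum {α : Type*} [MeasurableSpace α] {μ : Measure α} {F : ℕ → α → ℝ}
    {f : α → ℝ} (hF : ∀ n, Integrable (F n) μ) (hs : Summable fun n => ∫ a, ‖F n a‖ ∂μ)
    (h : ∀ᵐ a ∂μ, HasSum (fun n => F n a) (f a)) :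
    Integrable f μ ∧ HasSum (fun n => ∫ a, F n a ∂μ) (∫ a, f a ∂μ) := by
  constructor
  · constructor
    · refine aestronglyMeasurable_of_tendsto_ae Filter.atTop
        (f := fun N a => ∑ n ∈ Finset.range N, F n a) (fun N => ?_)
        (h.mono fun a ha => ha.tendsto_sum_nat)
      exact (integrable_finsetSum (Finset.range N) fun n _ => hF n).aestronglyMeasurable
    · have h1 : ∀ᵐ a ∂μ, ‖f a‖ₑ ≤ ∑' n, ‖F n a‖ₑ := by
        filter_upwards [h] with a ha
        rw [← ha.tsum_eq]
        exact enorm_tsum_le_tsum_enorm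
      refine (lintegral_mono_ae h1).trans_lt ?_
      rw [lintegral_tsum fun n => (hF n).aestronglyMeasurable.enorm]
      have h2 : ∀ n, ∫⁻ a, ‖F n a‖ₑ ∂μ = ENNReal.ofReal (∫ a, ‖F n a‖ ∂μ) := fun n => by
        rw [ofReal_integral_norm_eq_lintegral_enorm (hF n)]
      simp_rw [h2]
      rw [← ENNReal.ofReal_tsum_of_nonneg (fun n => integral_nonneg fun _ => norm_nonneg _) hs]
      exact ENNReal.ofReal_lt_top
  · have := hasSum_integral_of_summable_integral_norm hF hs
    rwa [integral_congr_ae (h.mono fun a ha => ha.tsum_eq)] at this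

/-- Expansion of the one-loop integral in powers of the difference of the masses. -/
theorem hasSum_one_loop {b m₁ m₂ p : ℝ} (hb : -1 / 2 < b) (h1 : 0 < m₁) (h2 : 0 < m₂) :
    HasSum (fun n : ℕ => bincoef (2 * b) (2 * n) * ∫ v in Ioo (-1 : ℝ) 1,
        (v * (m₂ - m₁)) ^ (2 * n) *
          ((m₁ + m₂) ^ 2 + (1 - v ^ 2) * p ^ 2) ^ (-(b + 1 / 2 + n)))
      (2 ^ (-(2 * b)) * ∫ v in (-1 : ℝ)..1,
        ((loopRoot (m₁ + m₂) p v + v * (m₂ - m₁)) / 2) ^ (-(2 * b)) /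
          loopRoot (m₁ + m₂) p v) := by
  set σ := m₁ + m₂ with hσ
  set δ := m₂ - m₁ with hδ
  have hδσ : |δ| < σ := by rw [abs_lt]; constructor <;> linarith
  have hσ0 : 0 < σ := by positivity
  have hIcc : uIcc (-1 : ℝ) 1 = Icc (-1) 1 := uIcc_of_le (by norm_num)
  have hR0 : ∀ v ∈ Icc (-1 : ℝ) 1, 0 < loopRoot σ p v := fun v hv =>
    hσ0.trans_le (le_loopRoot hv)
  have hRc : Continuous (loopRoot σ p) := by unfold loopRoot; fun_prop
  have hlt : ∀ v ∈ Icc (-1 : ℝ) 1, 0 < loopRoot σ p v + v * δ ∧ 0 < loopRoot σ p v - v * δ := by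
    intro v hv
    have := abs_lt.1 (abs_mul_lt_loopRoot (p := p) hδσ hv)
    constructor <;> linarith [this.1, this.2]
  let g : ℝ → ℝ := fun v => (loopRoot σ p v + v * δ) ^ (-(2 * b)) / loopRoot σ p v
  let g' : ℝ → ℝ := fun v => (loopRoot σ p v - v * δ) ^ (-(2 * b)) / loopRoot σ p v
  have hgi : IntervalIntegrable g volume (-1) 1 := by
    refine ContinuousOn.intervalIntegrable ?_
    rw [hIcc]
    refine ContinuousOn.div (ContinuousOn.rpow_const (by fun_prop) fun v hv =>
      Or.inl (hlt v hv).1.ne') hRc.continuousOn fun v hv => (hR0 v hv).ne'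
  have hgi' : IntervalIntegrable g' volume (-1) 1 := by
    refine ContinuousOn.intervalIntegrable ?_
    rw [hIcc]
    refine ContinuousOn.div (ContinuousOn.rpow_const (by fun_prop) fun v hv =>
      Or.inl (hlt v hv).2.ne') hRc.continuousOn fun v hv => (hR0 v hv).ne'
  -- `R` is even in `v`, so the integrand may be averaged with its reflection; this removes the odd
  -- powers of `δ`.
  have hgg : ∫ v in (-1 : ℝ)..1, g' v = ∫ v in (-1 : ℝ)..1, g v := by
    have := intervalIntegral.integral_comp_neg (a := -1) (b := 1) g
    rw [neg_neg] at this
    rw [← this]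
    refine intervalIntegral.integral_congr fun v _ => ?_
    simp only [g, g', loopRoot, neg_sq, neg_mul, sub_eq_add_neg]
  have hval : 2 ^ (-(2 * b)) * ∫ v in (-1 : ℝ)..1,
        ((loopRoot σ p v + v * δ) / 2) ^ (-(2 * b)) / loopRoot σ p v =
      ∫ v in (-1 : ℝ)..1, (g v + g' v) / 2 := by
    rw [intervalIntegral.integral_div, intervalIntegral.integral_add hgi hgi', hgg, add_self_div_two,
      ← intervalIntegral.integral_const_mul]
    refine intervalIntegral.integral_congr fun v hv => ?_
    rw [hIcc] at hv
    have := (hlt v hv).1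
    simp only [g]
    rw [Real.div_rpow this.le (by norm_num)]
    have : (2 : ℝ) ^ (-(2 * b)) ≠ 0 := by positivity
    field_simp
  let T : ℕ → ℝ → ℝ := fun n v => bincoef (2 * b) (2 * n) * ((v * δ) ^ (2 * n) *
    (σ ^ 2 + (1 - v ^ 2) * p ^ 2) ^ (-(b + 1 / 2 + n)))
  have hT : ∀ n, ∀ v ∈ Icc (-1 : ℝ) 1, T n v = loopRoot σ p v ^ (-(2 * b) - 1) *
      (bincoef (2 * b) (2 * n) * (v * δ / loopRoot σ p v) ^ (2 * n)) := by
    intro n v hv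
    have hR := hR0 v hv
    simp only [T]
    rw [← loopRoot_sq hv, ← Real.rpow_natCast (loopRoot σ p v), ← Real.rpow_mul hR.le, div_pow,
      ← Real.rpow_natCast (loopRoot σ p v) (2 * n),
      show ((2 : ℕ) : ℝ) * -(b + 1 / 2 + n) = (-(2 * b) - 1) - ((2 * n : ℕ) : ℝ) by
        push_cast; ring, Real.rpow_sub hR]
    ring
  -- A ratio below 1 that bounds `|vδ/R|` for all `v`, since both masses are positive and `R ≥ σ`;
  -- it gives a constant summable majorant.
  set θ := |δ| / σ with hθ
  have hθ0 : 0 ≤ θ := by positivity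
  have hθ1 : θ < 1 := by rwa [hθ, div_lt_one hσ0]
  have hw : ∀ v ∈ Icc (-1 : ℝ) 1, |v * δ / loopRoot σ p v| ≤ θ := by
    intro v hv
    have hR := hR0 v hv
    rw [abs_div, abs_of_pos hR, abs_mul]
    have : |v| ≤ 1 := abs_le.2 ⟨hv.1, hv.2⟩
    exact div_le_div₀ (abs_nonneg _) (mul_le_of_le_one_left (abs_nonneg _) this) hσ0
      (le_loopRoot hv)
  have hsub : uIoc (-1 : ℝ) 1 ⊆ Icc (-1) 1 := by
    rw [← hIcc]; exact uIoc_subset_uIcc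
  have hsum := (hasSum_even_bincoef (2 * b) (w := θ) (by rwa [abs_of_nonneg hθ0])).summable.abs
  have main := intervalIntegral.hasSum_integral_of_dominated_convergence (μ := volume)
    (a := -1) (b := 1) (F := T) (f := fun v => (g v + g' v) / 2)
    (bound := fun n _ => σ ^ (-(2 * b) - 1) * |bincoef (2 * b) (2 * n) * θ ^ (2 * n)|)
    (fun n => (by simp only [T]; fun_prop : Measurable (T n)).aestronglyMeasurable)
    (fun n => Filter.Eventually.of_forall fun v hv => ?_)
    (Filter.Eventually.of_forall fun v hv => hsum.mul_left _)
    intervalIntegrable_const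
    (Filter.Eventually.of_forall fun v hv => ?_)
  · rw [hval]
    refine hasSum_of_forall_eq main fun n => ?_
    rw [intervalIntegral.integral_of_le (by norm_num), integral_Ioc_eq_integral_Ioo,
      ← integral_const_mul]
  · have hv' := hsub hv
    have hR := hR0 v hv'
    rw [hT n v hv', norm_mul, Real.norm_of_nonneg (by positivity), Real.norm_eq_abs, abs_mul,
      abs_mul, abs_pow, abs_pow, abs_of_nonneg hθ0]
    refine mul_le_mul (Real.rpow_le_rpow_of_nonpos hσ0 (le_loopRoot hv') (by linarith))
      (mul_le_mul_of_nonneg_left (pow_le_pow_left₀ (abs_nonneg _) (hw v hv') _) (abs_nonneg _))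
      (by positivity) (by positivity)
  · have hv' := hsub hv
    have hR := hR0 v hv'
    have hwv := hw v hv'
    have hh := (hasSum_even_bincoef (2 * b) (w := v * δ / loopRoot σ p v)
      (hwv.trans_lt hθ1)).mul_left (loopRoot σ p v ^ (-(2 * b) - 1))
    have e : loopRoot σ p v ^ (-(2 * b) - 1) * (((1 + v * δ / loopRoot σ p v) ^ (-(2 * b)) +
        (1 - v * δ / loopRoot σ p v) ^ (-(2 * b))) / 2) = (g v + g' v) / 2 := by
      have e1 : 1 + v * δ / loopRoot σ p v = (loopRoot σ p v + v * δ) / loopRoot σ p v := by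
        field_simp
      have e2 : 1 - v * δ / loopRoot σ p v = (loopRoot σ p v - v * δ) / loopRoot σ p v := by
        field_simp
      rw [e1, e2, Real.div_rpow (hlt v hv').1.le hR.le, Real.div_rpow (hlt v hv').2.le hR.le,
        Real.rpow_sub_one hR.ne']
      have : loopRoot σ p v ^ (-(2 * b)) ≠ 0 := (Real.rpow_pos_of_pos hR _).ne'
      simp only [g, g']
      field_simp
    rw [e] at hh
    exact hasSum_of_forall_eq hh fun n => hT n v hv'

/-- The `n`-th term in the expansion of the one-loop integral. -/
def loopTerm (b p q : ℝ) (n : ℕ) (x u : ℝ) : ℝ :=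
  ∫ v in Ioo (-1 : ℝ) 1, (v * (2 * q * (x + q / 2))) ^ (2 * n) *
    ((2 * ((x + q / 2) ^ 2 + u) + q ^ 2 / 2) ^ 2 + (1 - v ^ 2) * p ^ 2) ^ (-(b + 1 / 2 + n))

/-- The constant in the integral of `loopTerm`. -/
def loopCoef (b m q : ℝ) (n : ℕ) : ℝ :=
  (2 * q) ^ (2 * n) * (Real.pi ^ ((m - 1) / 2) * Real.Gamma (n + 1 / 2) / Real.Gamma (m / 2 + n)) *
    ((q ^ 2 / 4) ^ (m / 2 + n) * (q ^ 2 / 2) ^ (-(2 * (b + 1 / 2 + n))))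

/-- For fixed `v` the integrand is `(x + q/2)^(2n)` times a profile in `(x + q/2)² + u`, so the
radial reduction applies after a shift by `q/2`. Nonnegativity is recorded because it later controls
the integrals of norms. -/
theorem integral_dimDiff_loopTerm {b m p q z : ℝ} (hm : 0 < m) (hb : m / 2 < 2 * b + 1) (hq : 0 < q)
    (hz0 : 0 ≤ z) (hz1 : z < 1) (hz : 4 * p ^ 2 / q ^ 4 = z / (1 - z)) (n : ℕ) :
    Integrable (dimDiff m (loopTerm b p q n)) (dimMeasure m) ∧
      (∀ y, 0 ≤ dimDiff m (loopTerm b p q n) y) ∧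
      ∫ y, dimDiff m (loopTerm b p q n) y ∂dimMeasure m =
        loopCoef b m q n * ∫ v in Ioo (-1 : ℝ) 1, v ^ (2 * n) *
          betaAverage (2 * b + 1 - m / 2 + n) (m / 2 + n) (b + 1 / 2 + n)
            (4 * p ^ 2 / q ^ 4 * (1 - v ^ 2)) := by
  have hn : (0 : ℝ) ≤ n := Nat.cast_nonneg n
  set c := b + 1 / 2 + n with hc
  have hc0 : 0 < c := by linarith
  let e : ℝ → ℝ → ℝ → ℝ := fun v x u => (v * (2 * q * (x + q / 2))) ^ (2 * n) *
    ((2 * ((x + q / 2) ^ 2 + u) + q ^ 2 / 2) ^ 2 + (1 - v ^ 2) * p ^ 2) ^ (-c)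
  have hmem : ∀ᵐ v ∂volume.restrict (Ioo (-1 : ℝ) 1), v ∈ Ioo (-1 : ℝ) 1 :=
    ae_restrict_mem measurableSet_Ioo
  have hv2 : ∀ v ∈ Icc (-1 : ℝ) 1, 0 ≤ 1 - v ^ 2 := fun v hv => by nlinarith [hv.1, hv.2]
  have hprof : ∀ v ∈ Ioo (-1 : ℝ) 1, IsProfile
      (fun K => ((2 * K + q ^ 2 / 2) ^ 2 + (1 - v ^ 2) * p ^ 2) ^ (-c)) _ := fun v hv =>
    isProfile_rpow (by positivity) (mul_nonneg (hv2 v (Ioo_subset_Icc_self hv)) (sq_nonneg p)) hc0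
  have heven : ∀ x : ℝ, 0 ≤ x ^ (2 * n) := fun x => by rw [pow_mul]; positivity
  have hee : ∀ v x u, e v x u = ((v * (2 * q)) ^ (2 * n) * (x + q / 2) ^ (2 * n)) *
      ((2 * ((x + q / 2) ^ 2 + u) + q ^ 2 / 2) ^ 2 + (1 - v ^ 2) * p ^ 2) ^ (-c) := fun v x u => by
    simp only [e]; rw [← mul_pow]; ring_nf
  have hed : ∀ v y, dimDiff m (e v) y = (v * (2 * q)) ^ (2 * n) * ((y.1 + q / 2) ^ (2 * n) *
      dimDiff m (fun x u => ((2 * ((x + q / 2) ^ 2 + u) + q ^ 2 / 2) ^ 2 +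
        (1 - v ^ 2) * p ^ 2) ^ (-c)) y) := fun v y => by
    have : e v = fun x u => ((v * (2 * q)) ^ (2 * n) * (x + q / 2) ^ (2 * n)) *
      ((2 * ((x + q / 2) ^ 2 + u) + q ^ 2 / 2) ^ 2 + (1 - v ^ 2) * p ^ 2) ^ (-c) := by
      ext x u; exact hee v x u
    rw [this, dimDiff_mul_left m (fun x => (v * (2 * q)) ^ (2 * n) * (x + q / 2) ^ (2 * n)), mul_assoc]
  have hnn : ∀ v ∈ Ioo (-1 : ℝ) 1, ∀ y, 0 ≤ dimDiff m (e v) y := fun v hv y => by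
    rw [hed]
    exact mul_nonneg (heven _) (mul_nonneg (heven _)
      ((hprof v hv).radialDiff_nonneg (m - 1) (y.1 + q / 2) y.2))
  have hf : ∀ x u : ℝ, 0 ≤ u → IntegrableOn (fun v => e v x u) (Ioo (-1) 1) := by
    intro x u hu
    refine (ContinuousOn.integrableOn_Icc ?_).mono_set Ioo_subset_Icc_self
    refine ContinuousOn.mul (by fun_prop) (ContinuousOn.rpow_const (by fun_prop) fun v hv => ?_)
    have := hv2 v hv
    exact Or.inl (by positivity)
  have hV0 : ∀ v ∈ Ioo (-1 : ℝ) 1, 0 ≤ betaAverage (2 * b + 1 - m / 2 + n) (m / 2 + n) c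
      (4 * p ^ 2 / q ^ 4 * (1 - v ^ 2)) := fun v hv => by
    have := hv2 v (Ioo_subset_Icc_self hv)
    exact betaAverage_nonneg (by positivity)
  have hL0 : 0 ≤ loopCoef b m q n := by
    have := Real.Gamma_pos_of_pos (s := m / 2 + n) (by positivity)
    have := Real.Gamma_pos_of_pos (s := (n : ℝ) + 1 / 2) (by positivity)
    unfold loopCoef; positivity
  have hav := (hasSum_betaAverage (a := 2 * b + 1 - m / 2 + n) (μ := m / 2 + n) (c := c)
    (by linarith) (by positivity) (by rw [hc]; ring) hz0 hz1 hz n).1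
  have main := dimDiff_integral_of_nonneg (Ω := ℝ) (μ := volume.restrict (Ioo (-1 : ℝ) 1)) (D := m)
    (e := e) (f := loopTerm b p q n) (V := fun v => loopCoef b m q n * (v ^ (2 * n) *
      betaAverage (2 * b + 1 - m / 2 + n) (m / 2 + n) c (4 * p ^ 2 / q ^ 4 * (1 - v ^ 2))))
    (by simp only [e]; fun_prop)
    (Filter.Eventually.of_forall fun x u hu => ⟨hf x u hu, rfl⟩)
    (hmem.mono fun v hv => hnn v hv) (hmem.mono fun v hv => ?_)
    (hmem.mono fun v hv => mul_nonneg hL0 (mul_nonneg (heven v) (hV0 v hv)))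
    (hav.const_mul _)
  · refine ⟨main.1, fun y => ?_, by rw [main.2, integral_const_mul]⟩
    have : dimDiff m (loopTerm b p q n) y = ∫ v in Ioo (-1 : ℝ) 1, dimDiff m (e v) y := by
      unfold dimDiff radialDiff
      split_ifs
      · rfl
      · rw [integral_sub (hf _ _ le_rfl) (hf _ _ (sq_nonneg _))]; rfl
    rw [this]
    exact setIntegral_nonneg measurableSet_Ioo fun v hv => hnn v hv y
  · simp_rw [hed, ENNReal.ofReal_mul (heven (v * (2 * q)))]
    rw [lintegral_const_mul' _ _ ENNReal.ofReal_ne_top, (hprof v hv).lintegral_dimDiff hm n (q / 2),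
      lintegral_rpow_mul_profile (X := 4 * p ^ 2 / q ^ 4 * (1 - v ^ 2)) (by positivity) ?_ ?_
        (by positivity) (by linarith), ← ENNReal.ofReal_mul, ← ENNReal.ofReal_mul (heven _)]
    · congr 1
      rw [loopCoef, show 2 * c - (m / 2 + n) = 2 * b + 1 - m / 2 + n by rw [hc]; ring, mul_pow v,
        show q ^ 2 / 2 / 2 = q ^ 2 / 4 by ring]
      ring
    · have := Real.Gamma_pos_of_pos (s := m / 2 + n) (by positivity)
      have := Real.Gamma_pos_of_pos (s := (n : ℝ) + 1 / 2) (by positivity)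
      positivity
    · have := hv2 v (Ioo_subset_Icc_self hv)
      positivity
    · field_simp; ring

/-- The constant in the expansion of the integral over the second vector. -/
def seriesCoef (b m q : ℝ) : ℝ :=
  2 * Real.pi ^ (m / 2) * Real.Gamma (2 * b + 1 - m / 2) / Real.Gamma (2 * b + 1) *
    ((q ^ 2 / 4) ^ (m / 2) * (q ^ 2 / 2) ^ (-(2 * b + 1)))

/-- All dependence on `n` is collected into `B_n`: `Γ(m/2 + n)`, `(b + 1/2)_n` and one `(1/2)_n`
cancel, while `1/(n + 1/2)` supplies `(1/2)_n / (3/2)_n`. -/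
theorem loopCoef_mul_beta {D m q : ℝ} (hD : D < 4) (hm : 0 < m) (ha : 0 < parA D m) (hq : 0 < q)
    (n : ℕ) :
    bincoef (2 * parB D) (2 * n) * (loopCoef (parB D) m q n *
      (ProbabilityTheory.beta (parA D m + n) (m / 2 + n) / (n + 1 / 2))) =
    seriesCoef (parB D) m q * coeffB D m n := by
  have ea : parA D m = 2 * parB D + 1 - m / 2 := by simp only [parA, parB]; ring
  have hb : -1 / 2 < parB D := by simp only [parB]; linarith
  unfold coeffB
  rw [ea] at ha ⊢
  generalize parB D = b at *
  have hG1 : Real.Gamma ((n : ℝ) + 1 / 2) = poch (1 / 2) n * Real.sqrt Real.pi := by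
    rw [add_comm, Gamma_add_nat (by norm_num), Real.Gamma_one_half_eq]
  have hG2 : Real.Gamma (2 * b + 1 - m / 2 + n + (m / 2 + n)) =
      4 ^ n * poch (b + 1 / 2) n * poch (b + 1) n * Real.Gamma (2 * b + 1) := by
    rw [show 2 * b + 1 - m / 2 + n + (m / 2 + n) = 2 * b + 1 + (2 * n : ℕ) by push_cast; ring,
      Gamma_add_nat (by linarith), poch_two_mul, show (2 * b + 1) / 2 = b + 1 / 2 by ring,
      show (2 * b + 1 + 1) / 2 = b + 1 by ring]
  have hpi : Real.pi ^ (m / 2) = Real.pi ^ ((m - 1) / 2) * Real.sqrt Real.pi := by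
    rw [Real.sqrt_eq_rpow, ← Real.rpow_add Real.pi_pos]; ring_nf
  have hq1 : (q ^ 2 / 4) ^ (m / 2 + n) = (q ^ 2 / 4) ^ (m / 2) * (q ^ 2 / 4) ^ n := by
    rw [Real.rpow_add (by positivity), Real.rpow_natCast]
  have hq2 : (q ^ 2 / 2) ^ (-(2 * (b + 1 / 2 + n))) =
      (q ^ 2 / 2) ^ (-(2 * b + 1)) * ((q ^ 2 / 2) ^ (2 * n))⁻¹ := by
    rw [← Real.rpow_natCast (q ^ 2 / 2) (2 * n), ← Real.rpow_neg (by positivity),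
      ← Real.rpow_add (by positivity)]
    push_cast; ring_nf
  -- The `n`-dependent powers of `q` collapse to `4^n`, exactly the factor in the duplication of
  -- `Γ(2b + 1 + 2n)`.
  have hq3 : (2 * q) ^ (2 * n) * ((q ^ 2 / 4) ^ n * ((q ^ 2 / 2) ^ (2 * n))⁻¹) = 4 ^ n := by
    rw [pow_mul, pow_mul, ← inv_pow, ← mul_pow, ← mul_pow]
    congr 1; field_simp; ring
  have hhalf : 1 / ((n : ℝ) + 1 / 2) = 2 * (poch (1 / 2) n / poch (3 / 2) n) := by
    rw [poch_half_div]; field_simp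
  have h1 := (Real.Gamma_pos_of_pos (s := m / 2 + n) (by positivity)).ne'
  have h2 := (Real.Gamma_pos_of_pos (s := 2 * b + 1) (by linarith)).ne'
  have h3 := (poch_pos (x := b + 1 / 2) (by linarith) n).ne'
  have h4 := (poch_pos (x := b + 1) (by linarith) n).ne'
  have h5 := (poch_pos (x := 1 / 2) (by norm_num) n).ne'
  have h6 := (poch_pos (x := 3 / 2) (by norm_num) n).ne'
  rw [bincoef_two_mul, loopCoef, seriesCoef, ProbabilityTheory.beta, div_eq_mul_one_div _ ((n : ℝ) + 1 / 2),
    hhalf, hG1, hG2, hq1, hq2, Gamma_add_nat ha, hpi]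
  generalize Real.Gamma (m / 2 + n) = g1 at *
  generalize Real.Gamma (2 * b + 1) = g2 at *
  generalize Real.Gamma (2 * b + 1 - m / 2) = g3 at *
  generalize (q ^ 2 / 4) ^ (m / 2) = r1 at *
  generalize (q ^ 2 / 2) ^ (-(2 * b + 1)) = r2 at *
  generalize Real.pi ^ ((m - 1) / 2) = r3 at *
  generalize poch (b + 1 / 2) n = p1 at *
  generalize poch (b + 1) n = p2 at *
  generalize poch (1 / 2) n = p3 at *
  generalize poch (3 / 2) n = p4 at *
  generalize ((q ^ 2 / 2) ^ (2 * n))⁻¹ = s1 at *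
  generalize (q ^ 2 / 4) ^ n = s2 at *
  generalize (2 * q) ^ (2 * n) = s3 at *
  have hne : s3 * (s2 * s1) ≠ 0 := by rw [hq3]; positivity
  rw [← hq3]
  have hs3 : s3 ≠ 0 := left_ne_zero_of_mul hne
  have hs2 : s2 ≠ 0 := left_ne_zero_of_mul (right_ne_zero_of_mul hne)
  have hs1 : s1 ≠ 0 := right_ne_zero_of_mul (right_ne_zero_of_mul hne)
  field_simp

/-- Legendre duplication for `Γ(2 - D/2) Γ((5 - D)/2)` produces `Γ(4 - D)`, which cancels `Γ(2b +
1)`; the powers of 2, `π` and `q` are then compared separately. -/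
theorem prefactor_eq {D m q : ℝ} (hD : D < 4) (hq : 0 < q) :
    ((2 * Real.pi) ^ m)⁻¹ * (((2 * Real.pi) ^ D)⁻¹ * (Real.pi ^ (D / 2) * Real.Gamma (2 - D / 2)) *
      2 ^ (2 * parB D) * seriesCoef (parB D) m q) = coeffA D m * q ^ (-4 + 2 * eps D m) := by
  have hp := Real.pi_pos
  have hdup := Real.Gamma_mul_Gamma_add_half (2 - D / 2)
  rw [show 2 - D / 2 + 1 / 2 = (5 - D) / 2 by ring, show 2 * (2 - D / 2) = 4 - D by ring] at hdup
  have g1 := (Real.Gamma_pos_of_pos (s := (5 - D) / 2) (by linarith)).ne'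
  have g2 := (Real.Gamma_pos_of_pos (s := 4 - D) (by linarith)).ne'
  have hdup' : Real.Gamma (2 - D / 2) =
      Real.Gamma (4 - D) * 2 ^ (1 - (4 - D)) * Real.pi ^ (1 / 2 : ℝ) / Real.Gamma ((5 - D) / 2) := by
    rw [eq_div_iff g1, hdup, Real.sqrt_eq_rpow]
  have hq1 : (q ^ 2 / 4) ^ (m / 2) = q ^ m * 2 ^ (-m) := by
    rw [show q ^ 2 / 4 = (q / 2) ^ (2 : ℝ) by rw [Real.rpow_two]; ring,
      ← Real.rpow_mul (by positivity), Real.div_rpow hq.le (by norm_num), Real.rpow_neg (by norm_num),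
      div_eq_mul_inv]
    ring_nf
  have hq2 : (q ^ 2 / 2) ^ (-(4 - D)) = q ^ (-(2 * (4 - D))) * 2 ^ (4 - D) := by
    rw [Real.div_rpow (by positivity) (by norm_num), ← Real.rpow_two, ← Real.rpow_mul hq.le,
      Real.rpow_neg (by norm_num) (4 - D), div_inv_eq_mul]
    ring_nf
  have hpiA : (16 * Real.pi) ^ ((D + m - 1) / 2) =
      2 ^ (2 * (D + m - 1)) * Real.pi ^ ((D + m - 1) / 2) := by
    rw [Real.mul_rpow (by norm_num) hp.le, show (16 : ℝ) = 2 ^ (4 : ℝ) by norm_num,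
      ← Real.rpow_mul (by norm_num)]
    ring_nf
  have e2 : (2 : ℝ) ^ (-m) * 2 ^ (-D) * 2 ^ (1 - (4 - D)) * 2 ^ (3 - D) * 2 ^ (1 : ℝ) * 2 ^ (-m) *
      2 ^ (4 - D) = 2 ^ (3 : ℝ) * 2 ^ (-(2 * (D + m - 1))) := by
    simp only [← Real.rpow_add (two_pos : (0 : ℝ) < 2)]
    congr 1; ring
  have e3 : Real.pi ^ (-m) * Real.pi ^ (-D) * Real.pi ^ (D / 2) * Real.pi ^ (1 / 2 : ℝ) *
      Real.pi ^ (m / 2) = Real.pi ^ (-((D + m - 1) / 2)) := by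
    simp only [← Real.rpow_add hp]
    congr 1; ring
  have e4 : q ^ m * q ^ (-(2 * (4 - D))) = q ^ (-4 + 2 * eps D m) := by
    rw [← Real.rpow_add hq, eps]; congr 1; ring
  unfold coeffA seriesCoef
  rw [show 2 * parB D + 1 - m / 2 = 2 - eps D m by simp only [parB, eps]; ring,
    show 2 * parB D + 1 = 4 - D by simp only [parB]; ring,
    show 2 * parB D = 3 - D by simp only [parB]; ring, hdup', hq1, hq2, ← e4, hpiA,
    ← Real.rpow_neg (by positivity), ← Real.rpow_neg (by positivity),
    Real.mul_rpow (by norm_num) hp.le, Real.mul_rpow (by norm_num) hp.le]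
  rw [Real.rpow_neg (by norm_num) (2 * (D + m - 1)), Real.rpow_one,
    show (2 : ℝ) ^ (3 : ℝ) = 8 by norm_num] at e2
  rw [Real.rpow_neg hp.le ((D + m - 1) / 2)] at e3
  calc _ = ((2 : ℝ) ^ (-m) * 2 ^ (-D) * 2 ^ (1 - (4 - D)) * 2 ^ (3 - D) * 2 * 2 ^ (-m) *
      2 ^ (4 - D)) * (Real.pi ^ (-m) * Real.pi ^ (-D) * Real.pi ^ (D / 2) *
        Real.pi ^ (1 / 2 : ℝ) * Real.pi ^ (m / 2)) * (q ^ m * q ^ (-(2 * (4 - D)))) *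
        (Real.Gamma (2 - eps D m) / Real.Gamma ((5 - D) / 2)) := by
        field_simp
    _ = _ := by rw [e2, e3]; field_simp

theorem varZeta_mem {p q : ℝ} (hp : 0 < p) (hq : 0 < q) :
    0 ≤ varZeta p q ∧ varZeta p q < 1 ∧ varX p q = varZeta p q / (1 - varZeta p q) ∧
      (1 - varZeta p q) = (1 + varX p q)⁻¹ := by
  have hX : 0 < varX p q := by unfold varX; positivity
  have e : 1 - varZeta p q = (1 + varX p q)⁻¹ := by unfold varZeta; field_simp; ring
  refine ⟨by unfold varZeta; positivity, ?_, ?_, e⟩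
  · have : 0 < (1 + varX p q)⁻¹ := by positivity
    linarith
  · rw [e, varZeta]; field_simp

theorem integral_dimDiff_loopTerm_eq {D m p q : ℝ} (hD : D < 4) (hm : 0 < m) (ha : 0 < parA D m)
    (hp : 0 < p) (hq : 0 < q) (n : ℕ) :
    bincoef (2 * parB D) (2 * n) * ∫ y, dimDiff m (loopTerm (parB D) p q n) y ∂dimMeasure m =
      seriesCoef (parB D) m q / (1 + varX p q) *
        (coeffB D m n * ∑' k, coeffF D m n k * varZeta p q ^ k) := by
  obtain ⟨hz0, hz1, hX, h1z⟩ := varZeta_mem hp hq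
  have ea : 2 * parB D + 1 - m / 2 = parA D m := by simp only [parA, parB]; ring
  have h := (hasSum_betaAverage (a := parA D m + n) (μ := m / 2 + n) (c := parB D + 1 / 2 + n)
    (by positivity) (by positivity) (by rw [← ea]; ring) hz0 hz1 hX n).2
  rw [(integral_dimDiff_loopTerm hm (by linarith) hq hz0 hz1 hX n).2.2, ea]
  rw [h1z, inv_inv] at h
  have e : ∀ k, ∑ j ∈ Finset.range (k + 1), (-1) ^ j * (k.choose j : ℝ) *
      (poch ((parA D m + n) / 2) j / poch (3 / 2 + n) j *
        (poch ((parA D m + n + 1) / 2) j / poch (parB D + 1 / 2 + n + 1 / 2) j)) =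
      coeffF D m n k := fun k => by
    rw [coeffF_eq_sum, show parB D + 1 / 2 + n + 1 / 2 = parB D + 1 + n by ring]
  simp only [e] at h
  have hv := h.tsum_eq
  rw [tsum_mul_left] at hv
  have hc := loopCoef_mul_beta hD hm ha hq n
  have hX0 : 1 + varX p q ≠ 0 := by
    have : 0 < varX p q := by unfold varX; positivity
    positivity
  have hv' : ∫ v in Ioo (-1 : ℝ) 1, v ^ (2 * n) * betaAverage (parA D m + n) (m / 2 + n)
      (parB D + 1 / 2 + n) (varX p q * (1 - v ^ 2)) = (1 + varX p q)⁻¹ *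
        (ProbabilityTheory.beta (parA D m + n) (m / 2 + n) / (n + 1 / 2) *
          ∑' k, coeffF D m n k * varZeta p q ^ k) := by
    rw [hv]; field_simp
  change _ * (_ * ∫ v in Ioo (-1 : ℝ) 1, v ^ (2 * n) * betaAverage (parA D m + n) (m / 2 + n)
      (parB D + 1 / 2 + n) (varX p q * (1 - v ^ 2))) = _
  rw [hv']
  linear_combination ((1 + varX p q)⁻¹ * ∑' k, coeffF D m n k * varZeta p q ^ k) * hc

/-- The inner integral of `feynmanI`. -/
def innerIntegral (D p q y w : ℝ) : ℝ :=
  ((2 * Real.pi) ^ D)⁻¹ * dimIntegral D (fun x u =>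
    1 / (x ^ 2 + u + (y ^ 2 + w) ^ 2) * (1 / ((x + p) ^ 2 + u + ((y + q) ^ 2 + w) ^ 2)))

/-- Excluding `y = 0` and `y = -q` keeps both masses positive even at `w = 0`, the value subtracted
when `m < 1`. -/
theorem hasSum_innerIntegral {D p q y w : ℝ} (hD : 0 < D) (hD4 : D < 4) (hp : 0 < p)
    (hy : y ≠ 0) (hyq : y + q ≠ 0) (hw : 0 ≤ w) :
    HasSum (fun n => ((2 * Real.pi) ^ D)⁻¹ * (Real.pi ^ (D / 2) * Real.Gamma (2 - D / 2)) *
        2 ^ (2 * parB D) * bincoef (2 * parB D) (2 * n) * loopTerm (parB D) p q n y w)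
      (innerIntegral D p q y w) := by
  have h1 : 0 < y ^ 2 + w := by positivity
  have h2 : 0 < (y + q) ^ 2 + w := by positivity
  have hb : -1 / 2 < parB D := by simp only [parB]; linarith
  obtain ⟨hi, hv⟩ := integral_dimDiff_one_loop hD hD4 h1 h2 hp
  rw [innerIntegral, dimIntegral_eq_integral hD hi, hv]
  have h := hasSum_one_loop (p := p) hb h1 h2
  rw [show -(2 * parB D) = D - 3 by simp only [parB]; ring] at h
  have h' := h.mul_left (((2 * Real.pi) ^ D)⁻¹ * (Real.pi ^ (D / 2) * Real.Gamma (2 - D / 2)) *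
    2 ^ (2 * parB D))
  have e : (2 : ℝ) ^ (2 * parB D) * 2 ^ (D - 3) = 1 := by
    rw [← Real.rpow_add two_pos, show 2 * parB D + (D - 3) = 0 by simp only [parB]; ring,
      Real.rpow_zero]
  rw [mul_assoc _ ((2 : ℝ) ^ (2 * parB D)), ← mul_assoc ((2 : ℝ) ^ (2 * parB D)), e, one_mul,
    mul_assoc] at h'
  simp only [mul_assoc] at h' ⊢
  refine hasSum_of_forall_eq h' fun n => ?_
  have el : loopTerm (parB D) p q n y w = ∫ v in Ioo (-1 : ℝ) 1,
      (v * ((y + q) ^ 2 + w - (y ^ 2 + w))) ^ (2 * n) *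
        ((y ^ 2 + w + ((y + q) ^ 2 + w)) ^ 2 + (1 - v ^ 2) * p ^ 2) ^ (-(parB D + 1 / 2 + n)) := by
    rw [loopTerm]
    refine integral_congr_ae (Filter.Eventually.of_forall fun v => ?_)
    simp only
    rw [show (y + q) ^ 2 + w - (y ^ 2 + w) = 2 * q * (y + q / 2) by ring,
      show y ^ 2 + w + ((y + q) ^ 2 + w) = 2 * ((y + q / 2) ^ 2 + w) + q ^ 2 / 2 by ring]
  rw [el]

theorem integral_innerIntegral {D m p q : ℝ} (hD : 0 < D) (hm : 0 < m) (ha : 0 < parA D m)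
    (ha2 : parA D m < 2) (hp : 0 < p) (hq : 0 < q) :
    Integrable (dimDiff m (innerIntegral D p q)) (dimMeasure m) ∧
      ((2 * Real.pi) ^ m)⁻¹ * ∫ z, dimDiff m (innerIntegral D p q) z ∂dimMeasure m =
        coeffA D m * q ^ (-4 + 2 * eps D m) / (1 + varX p q) *
          ∑' nk : ℕ × ℕ, coeffB D m nk.1 * coeffF D m nk.1 nk.2 * varZeta p q ^ nk.2 := by
  have hD4 : D < 4 := by simp only [parA] at ha; linarith
  obtain ⟨hz0, hz1, hX, h1z⟩ := varZeta_mem hp hq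
  have ea : 2 * parB D + 1 - m / 2 = parA D m := by simp only [parA, parB]; ring
  have hXpos : 0 < 1 + varX p q := by
    have : 0 < varX p q := by unfold varX; positivity
    positivity
  set C := ((2 * Real.pi) ^ D)⁻¹ * (Real.pi ^ (D / 2) * Real.Gamma (2 - D / 2)) *
    2 ^ (2 * parB D) with hC
  let F : ℕ → ℝ × ℝ → ℝ := fun n z =>
    C * bincoef (2 * parB D) (2 * n) * dimDiff m (loopTerm (parB D) p q n) z
  have hterm := fun n => integral_dimDiff_loopTerm (b := parB D) hm (by linarith) hq hz0 hz1 hX n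
  have hFi : ∀ n, Integrable (F n) (dimMeasure m) := fun n => (hterm n).1.const_mul _
  have hFv : ∀ n, ∫ z, F n z ∂dimMeasure m = C * (seriesCoef (parB D) m q / (1 + varX p q) *
        (coeffB D m n * ∑' k, coeffF D m n k * varZeta p q ^ k)) := fun n => by
    rw [← integral_dimDiff_loopTerm_eq hD4 hm ha hp hq n, integral_const_mul, mul_assoc]
  -- Each `F n` is a constant times a nonnegative function, so the absolute convergence of the
  -- double series already bounds the sum of the norms.
  have hFn : ∀ n, ∫ z, ‖F n z‖ ∂dimMeasure m = |∫ z, F n z ∂dimMeasure m| := fun n => by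
    have e : ∀ z, ‖F n z‖ = |C * bincoef (2 * parB D) (2 * n)| *
        dimDiff m (loopTerm (parB D) p q n) z := fun z => by
      rw [Real.norm_eq_abs, abs_mul, abs_of_nonneg ((hterm n).2.1 z)]
    simp_rw [e]
    rw [integral_const_mul, integral_const_mul, abs_mul (C * bincoef (2 * parB D) (2 * n)),
      abs_of_nonneg (integral_nonneg (hterm n).2.1)]
  have hdouble := summable_coeffB_mul_coeffF hD4 hm ha ha2 hz0 hz1
  have hsum : Summable fun n => ∫ z, ‖F n z‖ ∂dimMeasure m := by
    simp_rw [hFn, hFv]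
    have h := hdouble.prod
    simp only [mul_assoc, tsum_mul_left] at h
    exact ((h.mul_left _).mul_left _).abs
  have hhas : ∀ᵐ z ∂dimMeasure m, HasSum (fun n => F n z) (dimDiff m (innerIntegral D p q) z) := by
    have hy : ∀ᵐ y : ℝ, y ≠ 0 ∧ y + q ≠ 0 := by
      have h1 : ∀ᵐ y : ℝ, y ≠ 0 := Measure.ae_ne volume 0
      have h2 : ∀ᵐ y : ℝ, y ≠ -q := Measure.ae_ne volume (-q)
      filter_upwards [h1, h2] with y h1 h2
      exact ⟨h1, fun h => h2 (by linarith)⟩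
    have h := (Measure.quasiMeasurePreserving_fst (μ := (volume : Measure ℝ))
      (ν := radialMeasure (m - 1))).ae hy
    refine h.mono fun z hz => ?_
    have h1 := hasSum_innerIntegral hD hD4 hp hz.1 hz.2 (sq_nonneg z.2)
    have h0 := hasSum_innerIntegral hD hD4 hp hz.1 hz.2 le_rfl
    simp only [F]
    unfold dimDiff radialDiff
    split_ifs
    · exact h1
    · simp only [mul_sub]
      exact h0.sub h1
  obtain ⟨hI, hS⟩ := integrable_of_hasSum hFi hsum hhas
  refine ⟨hI, ?_⟩
  rw [← hS.tsum_eq]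
  simp_rw [hFv]
  rw [tsum_mul_left, tsum_mul_left, hdouble.tsum_prod, mul_div_assoc]
  simp only [mul_assoc, tsum_mul_left]
  have := prefactor_eq (m := m) hD4 hq
  rw [← hC] at this
  linear_combination ((1 + varX p q)⁻¹ * ∑' n, coeffB D m n *
    ∑' k, coeffF D m n k * varZeta p q ^ k) * this

/-- The expansion in arbitrary real dimensions. -/
theorem feynmanI_eq_tsum {D m p q : ℝ} (hD : 0 < D) (hm : 0 < m) (he0 : 0 < eps D m)
    (he2 : eps D m < 2) (hp : 0 < p) (hq : 0 < q) :
    Summable (fun nk : ℕ × ℕ => coeffB D m nk.1 * coeffF D m nk.1 nk.2 * varZeta p q ^ nk.2) ∧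
      feynmanI D m p q = coeffA D m * q ^ (-4 + 2 * eps D m) / (1 + varX p q) *
        ∑' nk : ℕ × ℕ, coeffB D m nk.1 * coeffF D m nk.1 nk.2 * varZeta p q ^ nk.2 := by
  have ha : 0 < parA D m := by simp only [parA, eps] at *; linarith
  have ha2 : parA D m < 2 := by simp only [parA, eps] at *; linarith
  have hD4 : D < 4 := by simp only [parA] at ha; linarith
  obtain ⟨hz0, hz1, -, -⟩ := varZeta_mem hp hq
  obtain ⟨hI, hv⟩ := integral_innerIntegral hD hm ha ha2 hp hq
  refine ⟨summable_coeffB_mul_coeffF hD4 hm ha ha2 hz0 hz1, ?_⟩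
  rw [← hv, ← dimIntegral_eq_integral hm hI]
  rfl

/-! ### Integer dimensions -/

theorem ae_nonneg_radialMeasure (ν : ℝ) : ∀ᵐ t ∂radialMeasure ν, 0 ≤ t := by
  unfold radialMeasure
  split_ifs
  · rw [ae_dirac_iff measurableSet_Ici]
  · refine (withDensity_absolutelyContinuous _ _).ae_le ?_
    filter_upwards [ae_restrict_mem measurableSet_Ioi] with t ht using le_of_lt ht

theorem radialMeasure_Iio {ν : ℝ} (hν : 0 ≤ ν) {r : ℝ} (hr : 0 < r) :
    radialMeasure ν (Iio r) = ENNReal.ofReal (Real.pi ^ (ν / 2) / Real.Gamma (ν / 2 + 1) * r ^ ν) := by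
  have h := lintegral_radialDiff_ballInd (ν := ν) (by linarith) (r ^ 2)
  rw [if_pos (by positivity), ← Real.rpow_natCast, ← Real.rpow_mul hr.le, Nat.cast_ofNat,
    mul_div_cancel₀ _ (two_ne_zero' ℝ)] at h
  rw [← h, ← lintegral_indicator_one measurableSet_Iio]
  refine lintegral_congr_ae ?_
  filter_upwards [ae_nonneg_radialMeasure ν] with t ht
  have : t ^ 2 < r ^ 2 ↔ t < r := by
    rw [sq_lt_sq, abs_of_nonneg ht, abs_of_pos hr]
  simp only [radialDiff, if_pos hν, ballInd, Real.rpow_two, this, indicator, mem_Iio]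
  split_ifs <;> simp

theorem volume_ball_euclidean (k : ℕ) {r : ℝ} (hr : 0 < r) :
    volume (Metric.ball (0 : EuclideanSpace ℝ (Fin k)) r) =
      ENNReal.ofReal (Real.pi ^ ((k : ℝ) / 2) / Real.Gamma ((k : ℝ) / 2 + 1) * r ^ (k : ℝ)) := by
  rcases Nat.eq_zero_or_pos k with rfl | hk
  · rw [volume_euclideanSpace_eq_dirac]
    simp [hr]
  · have : Nonempty (Fin k) := Fin.pos_iff_nonempty.mp hk
    rw [EuclideanSpace.volume_ball, Fintype.card_fin, ← ENNReal.ofReal_pow hr.le,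
      ← ENNReal.ofReal_mul (by positivity), Real.rpow_natCast, Real.sqrt_eq_rpow,
      ← Real.rpow_natCast (Real.pi ^ (1 / 2 : ℝ)), ← Real.rpow_mul Real.pi_pos.le]
    congr 1
    ring_nf

/-- Both measures give the half lines `Iio r` the volume of the `k`-ball of radius `r`, and these
form a generating π-system. For `k = 0` both are the Dirac mass at 0. -/
theorem map_norm_volume (k : ℕ) :
    Measure.map (fun x : EuclideanSpace ℝ (Fin k) => ‖x‖) volume = radialMeasure (k : ℝ) := by
  have hball : ∀ r : ℝ, Measure.map (fun x : EuclideanSpace ℝ (Fin k) => ‖x‖) volume (Iio r) =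
      volume (Metric.ball (0 : EuclideanSpace ℝ (Fin k)) r) := fun r => by
    rw [Measure.map_apply measurable_norm measurableSet_Iio]
    congr 1
    ext x; simp
  refine Measure.ext_of_generateFrom_of_iUnion (range Iio) (fun i : ℕ => Iio (i : ℝ))
    (BorelSpace.measurable_eq.trans (borel_eq_generateFrom_Iio ℝ)) isPiSystem_Iio ?_ ?_ ?_ ?_
  · refine iUnion_eq_univ_iff.2 fun x => ?_
    obtain ⟨n, hn⟩ := exists_nat_gt x
    exact ⟨n, hn⟩
  · exact fun i => mem_range_self _
  · intro i
    rw [hball]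
    exact measure_ball_lt_top.ne
  · rintro _ ⟨r, rfl⟩
    rw [hball]
    rcases le_or_gt r 0 with hr | hr
    · rw [Metric.ball_eq_empty.2 hr, measure_empty]
      refine (measure_mono_null (fun t ht => ?_) (ae_nonneg_radialMeasure (k : ℝ))).symm
      exact not_le.2 (lt_of_lt_of_le ht hr)
    · rw [volume_ball_euclidean k hr, radialMeasure_Iio (Nat.cast_nonneg k) hr]

theorem exists_measurePreserving_fst_norm (k : ℕ) :
    ∃ φ : EuclideanSpace ℝ (Fin (k + 1)) → ℝ × ℝ,
      MeasurePreserving φ volume (dimMeasure ((k + 1 : ℕ) : ℝ)) ∧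
        ∀ x, (φ x).1 = x 0 ∧ ‖x‖ ^ 2 = (φ x).1 ^ 2 + (φ x).2 ^ 2 := by
  have h1 := PiLp.volume_preserving_ofLp (Fin (k + 1))
  have h2 := volume_preserving_piFinSuccAbove (fun _ : Fin (k + 1) => ℝ) 0
  have h3 : MeasurePreserving (Prod.map id (fun y : Fin k → ℝ => ‖WithLp.toLp 2 y‖))
      ((volume : Measure ℝ).prod (volume : Measure (Fin k → ℝ)))
      ((volume : Measure ℝ).prod (radialMeasure (k : ℝ))) := by
    refine (MeasurePreserving.id volume).prod ?_
    have hn : MeasurePreserving (fun x : EuclideanSpace ℝ (Fin k) => ‖x‖) volume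
      (radialMeasure (k : ℝ)) := ⟨measurable_norm, map_norm_volume k⟩
    exact hn.comp (PiLp.volume_preserving_toLp (Fin k))
  refine ⟨fun x => Prod.map id (fun y : Fin k → ℝ => ‖WithLp.toLp 2 y‖)
    (MeasurableEquiv.piFinSuccAbove (fun _ : Fin (k + 1) => ℝ) 0 (WithLp.ofLp x)),
    ?_, fun x => ⟨?_, ?_⟩⟩
  · have := h3.comp (h2.comp h1)
    rw [dimMeasure, show ((k + 1 : ℕ) : ℝ) - 1 = k by push_cast; ring]
    exact this
  · rfl
  · simp only [Prod.map, id]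
    rw [EuclideanSpace.norm_sq_eq, EuclideanSpace.norm_sq_eq, Fin.sum_univ_succ]
    simp [MeasurableEquiv.piFinSuccAbove, Fin.tail]

/-- Decomposition of Euclidean space along a nonzero vector. -/
theorem exists_measurePreserving_component {D : ℕ} (hD : 0 < D) (p : EuclideanSpace ℝ (Fin D)) :
    ∃ φ : EuclideanSpace ℝ (Fin D) → ℝ × ℝ, MeasurePreserving φ volume (dimMeasure (D : ℝ)) ∧
      ∀ x, ‖x‖ ^ 2 = (φ x).1 ^ 2 + (φ x).2 ^ 2 ∧
        ‖x + p‖ ^ 2 = ((φ x).1 + ‖p‖) ^ 2 + (φ x).2 ^ 2 := by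
  obtain ⟨k, rfl⟩ : ∃ k, D = k + 1 := ⟨D - 1, by omega⟩
  obtain ⟨φ, hφ, hφ'⟩ := exists_measurePreserving_fst_norm k
  let w : EuclideanSpace ℝ (Fin (k + 1)) := EuclideanSpace.single 0 ‖p‖
  have hw : ‖p‖ = ‖w‖ := by simp [w]
  -- The reflection exchanging `p` with the vector `w` of equal length on the first axis; it
  -- preserves volume and reduces to the first coordinate.
  let T := (Submodule.span ℝ {p - w})ᗮ.reflection
  have hT : T p = w := Submodule.reflection_sub hw
  refine ⟨φ ∘ T, hφ.comp T.measurePreserving, fun x => ?_⟩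
  obtain ⟨h1, h2⟩ := hφ' (T x)
  have hx : ‖x‖ ^ 2 = (φ (T x)).1 ^ 2 + (φ (T x)).2 ^ 2 := by rw [← h2, T.norm_map]
  refine ⟨hx, ?_⟩
  have e : inner ℝ x p = (φ (T x)).1 * ‖p‖ := by
    rw [← T.inner_map_map, hT, h1, EuclideanSpace.inner_single_right]
    simp [mul_comm]
  rw [norm_add_sq_real, hx, e]
  simp only [Function.comp]
  ring

theorem dimDiff_of_one_le {D : ℝ} (hD : 1 ≤ D) (f : ℝ → ℝ → ℝ) (z : ℝ × ℝ) :
    dimDiff D f z = f z.1 (z.2 ^ 2) := by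
  rw [dimDiff, radialDiff, if_pos (by linarith)]

theorem integral_integrand_inner {D m : ℕ} (hD : 0 < D) (hD4 : (D : ℝ) < 4)
    (p : EuclideanSpace ℝ (Fin D)) (hp : p ≠ 0) (q q' : EuclideanSpace ℝ (Fin m))
    (h1 : q' ≠ 0) (h2 : q' + q ≠ 0) {y w : ℝ} (hy : ‖q'‖ ^ 2 = y ^ 2 + w)
    (hyq : ‖q' + q‖ ^ 2 = (y + ‖q‖) ^ 2 + w) :
    Integrable (integrand p q q') ∧ ((2 * Real.pi) ^ D)⁻¹ * ∫ p', integrand p q q' p' =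
      innerIntegral D ‖p‖ ‖q‖ y w := by
  have hD1 : (1 : ℝ) ≤ D := by exact_mod_cast hD
  obtain ⟨φ, hφ, hφ'⟩ := exists_measurePreserving_component hD p
  have hm1 : 0 < y ^ 2 + w := by rw [← hy]; positivity
  have hm2 : 0 < (y + ‖q‖) ^ 2 + w := by rw [← hyq]; positivity
  obtain ⟨hi, -⟩ := integral_dimDiff_one_loop (p := ‖p‖) (by linarith) hD4 hm1 hm2
    (norm_pos_iff.2 hp)
  have e : integrand p q q' = fun x => dimDiff D (fun x u => 1 / (x ^ 2 + u + (y ^ 2 + w) ^ 2) *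
      (1 / ((x + ‖p‖) ^ 2 + u + ((y + ‖q‖) ^ 2 + w) ^ 2))) (φ x) := by
    ext x
    obtain ⟨a1, a2⟩ := hφ' x
    rw [dimDiff_of_one_le hD1, integrand, a1, a2, show ‖q'‖ ^ 4 = (‖q'‖ ^ 2) ^ 2 by ring,
      show ‖q' + q‖ ^ 4 = (‖q' + q‖ ^ 2) ^ 2 by ring, hy, hyq]
  rw [e]
  refine ⟨hφ.integrable_comp_of_integrable hi, ?_⟩
  rw [innerIntegral, dimIntegral_eq_integral (by linarith) hi, Real.rpow_natCast]
  congr 1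
  have := hi.aestronglyMeasurable
  rw [← hφ.map_eq] at this ⊢
  exact (integral_map hφ.aemeasurable this).symm

/-- In integer dimensions at least 1, `dimDiff` is plain evaluation and `dimMeasure` is the image of
Lebesgue measure. The integrand is nonnegative, so integrability of the inner integrals gives joint
integrability. -/
theorem integral_integrand {D m : ℕ} (hD : 0 < D) (hm : 0 < m) (he0 : 0 < eps D m)
    (he2 : eps D m < 2) (p : EuclideanSpace ℝ (Fin D)) (q : EuclideanSpace ℝ (Fin m))
    (hp : p ≠ 0) (hq : q ≠ 0) :
    Integrable (fun z : EuclideanSpace ℝ (Fin m) × EuclideanSpace ℝ (Fin D) =>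
        integrand p q z.1 z.2) ∧
      ((2 * Real.pi) ^ m)⁻¹ * ∫ q' : EuclideanSpace ℝ (Fin m), ((2 * Real.pi) ^ D)⁻¹ *
        ∫ p' : EuclideanSpace ℝ (Fin D), integrand p q q' p' = feynmanI D m ‖p‖ ‖q‖ := by
  have hD1 : (1 : ℝ) ≤ D := by exact_mod_cast hD
  have hm1 : (1 : ℝ) ≤ m := by exact_mod_cast hm
  have ha : 0 < parA D m := by simp only [parA, eps] at *; linarith
  have ha2 : parA D m < 2 := by simp only [parA, eps] at *; linarith
  have hD4 : (D : ℝ) < 4 := by simp only [parA] at ha; linarith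
  have hq0 := norm_pos_iff.2 hq
  obtain ⟨hI, -⟩ := integral_innerIntegral (D := D) (m := m) (by linarith) (by linarith) ha ha2
    (norm_pos_iff.2 hp) hq0
  obtain ⟨φ, hφ, hφ'⟩ := exists_measurePreserving_component hm q
  have hgood : ∀ᵐ q' : EuclideanSpace ℝ (Fin m), q' ≠ 0 ∧ q' + q ≠ 0 := by
    have : Nonempty (Fin m) := Fin.pos_iff_nonempty.mp hm
    have h1 : ∀ᵐ x : EuclideanSpace ℝ (Fin m), x ≠ 0 := Measure.ae_ne volume 0
    have h2 : ∀ᵐ x : EuclideanSpace ℝ (Fin m), x ≠ -q := Measure.ae_ne volume (-q)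
    filter_upwards [h1, h2] with x h1 h2
    exact ⟨h1, fun h => h2 (eq_neg_of_add_eq_zero_left h)⟩
  have hinner : ∀ᵐ q' : EuclideanSpace ℝ (Fin m), Integrable (integrand p q q') ∧
      ((2 * Real.pi) ^ D)⁻¹ * ∫ p', integrand p q q' p' =
        dimDiff m (innerIntegral D ‖p‖ ‖q‖) (φ q') := by
    filter_upwards [hgood] with q' hq'
    rw [dimDiff_of_one_le hm1]
    exact integral_integrand_inner hD hD4 p hp q q' hq'.1 hq'.2 (hφ' q').1 (hφ' q').2
  have hmeas : Measurable fun z : EuclideanSpace ℝ (Fin m) × EuclideanSpace ℝ (Fin D) =>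
      integrand p q z.1 z.2 := by
    unfold integrand; fun_prop
  have hnn : ∀ q' p', 0 ≤ integrand p q q' p' := fun q' p' => by unfold integrand; positivity
  constructor
  · rw [Measure.volume_eq_prod, integrable_prod_iff hmeas.aestronglyMeasurable]
    refine ⟨hinner.mono fun q' h => h.1, ?_⟩
    refine ((hφ.integrable_comp_of_integrable hI).const_mul ((2 * Real.pi) ^ D)).congr ?_
    filter_upwards [hinner] with q' h
    simp only [Real.norm_of_nonneg (hnn _ _), Function.comp]
    rw [← h.2]
    have : (2 * Real.pi) ^ D ≠ 0 := by positivity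
    field_simp
  · rw [integral_congr_ae (hinner.mono fun q' h => h.2)]
    have e : feynmanI D m ‖p‖ ‖q‖ =
        ((2 * Real.pi) ^ (m : ℝ))⁻¹ * dimIntegral m (innerIntegral D ‖p‖ ‖q‖) := rfl
    rw [e, dimIntegral_eq_integral (by linarith) hI, Real.rpow_natCast]
    congr 1
    have := hI.aestronglyMeasurable
    rw [← hφ.map_eq] at this ⊢
    exact (integral_map hφ.aemeasurable this).symm

end Lifshitz

end

theorem theorem6 :
    -- the expansion, for all real dimensions inside the convergence region
    (∀ D m : ℝ, 0 < D → 0 < m → 0 < Lifshitz.eps D m → Lifshitz.eps D m < 2 →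
      ∀ p q : ℝ, 0 < p → 0 < q →
        Summable (fun nk : ℕ × ℕ => Lifshitz.coeffB D m nk.1 * Lifshitz.coeffF D m nk.1 nk.2 *
          Lifshitz.varZeta p q ^ nk.2) ∧
        Lifshitz.feynmanI D m p q =
          Lifshitz.coeffA D m * q ^ (-4 + 2 * Lifshitz.eps D m) / (1 + Lifshitz.varX p q) *
            ∑' nk : ℕ × ℕ, Lifshitz.coeffB D m nk.1 * Lifshitz.coeffF D m nk.1 nk.2 *
              Lifshitz.varZeta p q ^ nk.2) ∧
    -- for integer dimensions the left-hand side is the genuine Lebesgue integral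
    (∀ D m : ℕ, 0 < D → 0 < m → 0 < Lifshitz.eps D m → Lifshitz.eps D m < 2 →
      ∀ (p : EuclideanSpace ℝ (Fin D)) (q : EuclideanSpace ℝ (Fin m)), p ≠ 0 → q ≠ 0 →
        Integrable (fun z : EuclideanSpace ℝ (Fin m) × EuclideanSpace ℝ (Fin D) =>
          Lifshitz.integrand p q z.1 z.2) ∧
        ((2 * Real.pi) ^ m)⁻¹ * ∫ q' : EuclideanSpace ℝ (Fin m),
          ((2 * Real.pi) ^ D)⁻¹ * ∫ p' : EuclideanSpace ℝ (Fin D),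
            Lifshitz.integrand p q q' p' =
          Lifshitz.feynmanI D m ‖p‖ ‖q‖) :=
  ⟨fun _ _ hD hm he0 he2 _ _ hp hq => Lifshitz.feynmanI_eq_tsum hD hm he0 he2 hp hq,
    fun _ _ hD hm he0 he2 p q hp hq => Lifshitz.integral_integrand hD hm he0 he2 p q hp hq⟩
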